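/- Let $R$ be a commutative ring with unbounded derived category $\mathbf D(R)$, and let $\mathbf D(R)^c$ be its full subcategory of compact objects (those $X$ for which $\operatorname{Hom}(X,-)$ preserves coproducts). All subcategories are full. A *definable $\otimes$-ideal* of $\mathbf D(R)$ is a thick subcategory $\mathcal D$ such that $X\otimes_R^{\mathbf L}Y\in\mathcal D$ for all $X\in\mathbf D(R)$, $Y\in\mathcal D$, and such that $\mathcal D=\{X\mid \operatorname{Hom}(f,X)=0 \text{ for all } f\in\Phi\}$ for some set $\Phi$ of morphisms of $\mathbf D(R)^c$. It is *closed under cohomology* if $X\in\mathcal D$ implies $H^*(X)=\bigoplus_{n\in\mathbb Z}H^n(X)\in\mathcal D$ (a module being viewed as a complex in degree $0$). It is *compactly generated* if $\mathcal D=\mathcal S^\perp=\{X\mid \operatorname{Hom}(S,\Sigma^iX)=0\ \text{ for all } S\in\mathcal S,\ i\in\mathbb Z\}$ for some thick $\otimes$-ideal $\mathcal S$ of $\mathbf D(R)^c$. $\mathbf D(R)$ satisfies the *Restricted Telescope Conjecture* (RTC) if every definable $\otimes$-ideal of $\mathbf D(R)$ that is closed under cohomology is compactly generated. A ring epimorphism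 $R\to S$ is *pseudoflat* if $\operatorname{Tor}_1^R(S,S)=0$, and *flat* if $S$ is a flat $R$-module. **Proposition 5.7.** Let $R$ be a local commutative ring with a proper non-zero ideal $I$ such that $I=I^2$. Then: 1. the projection $R\to R/I$ is a pseudoflat ring epimorphism which is not flat; 2. the subcategory $\{X\in\mathbf D(R)\mid H^*(X) \text{ is isomorphic to the restriction to } R \text{ of an } R/I\text{-module}\}$ is a definable $\otimes$-ideal of $\mathbf D(R)$ that is closed under cohomology and is not compactly generated; 3. $\mathbf D(R)$ fails (RTC). -/

import Mathlib

universe w u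

open CategoryTheory Limits Pretriangulated

noncomputable section

namespace DerivedTelescope

section General

variable {T : Type*} [Category* T] [Preadditive T]

/-- An object `X` is compact if `Hom(X, -)` preserves coproducts indexed by sets (the sets being
the types in `Type u`). -/
def IsCompactObject (X : T) : Prop :=
  ∀ J : Type u, PreservesColimitsOfShape (Discrete J) (preadditiveCoyoneda.obj (Opposite.op X))

/-- A full subcategory `D` is definable if there are morphisms `Φ` between compact objects such
that `D` consists of the objects `X` for which `Hom(f, X) : Hom(B, X) → Hom(A, X)` is zero for all
`f : A ⟶ B` in `Φ`. -/
def IsDefinable (D : ObjectProperty T) : Prop :=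
  ∃ Φ : MorphismProperty T,
    (∀ ⦃A B : T⦄ (f : A ⟶ B), Φ f → IsCompactObject.{u} A ∧ IsCompactObject.{u} B) ∧
    ∀ X : T, D X ↔ ∀ ⦃A B : T⦄ (f : A ⟶ B), Φ f → ∀ g : B ⟶ X, f ≫ g = 0

variable [HasZeroObject T] [HasShift T ℤ] [∀ n : ℤ, (shiftFunctor T n).Additive]
  [Pretriangulated T]

/-- Thick subcategories: triangulated subcategories closed under direct summands. -/
structure IsThick (S : ObjectProperty T) : Prop where
  isTriangulated : S.IsTriangulated
  isStableUnderRetracts : S.IsStableUnderRetracts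

/-- The right orthogonal `{X | Hom(s, Σ^i X) = 0 for all s ∈ S and i ∈ ℤ}`. -/
def perp (S : ObjectProperty T) : ObjectProperty T :=
  fun X => ∀ ⦃s : T⦄, S s → ∀ (i : ℤ) (g : s ⟶ X⟦i⟧), g = 0

end General

variable {R : Type u} [CommRing R] [HasDerivedCategory.{w} (ModuleCat.{u} R)]

/-- `IsDerivedTensor X Y Z` says that `Z` is (isomorphic to) the derived tensor product
`X ⊗ᴸ Y` in `D(R)`: it is computed as the total tensor product `P ⊗ N` of a K-projective
complex `P` representing `X` and a complex `N` representing `Y`. -/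
def IsDerivedTensor (X Y Z : DerivedCategory (ModuleCat.{u} R)) : Prop :=
  ∃ P N : CochainComplex (ModuleCat.{u} R) ℤ, P.IsKProjective ∧
    Nonempty (DerivedCategory.Q.obj P ≅ X) ∧ Nonempty (DerivedCategory.Q.obj N ≅ Y) ∧
    Nonempty (DerivedCategory.Q.obj (HomologicalComplex.tensorObj P N) ≅ Z)

/-- Definable `⊗`-ideals of `D(R)`. -/
structure IsDefinableTensorIdeal
    (D : ObjectProperty (DerivedCategory (ModuleCat.{u} R))) : Prop where
  isThick : IsThick D
  tensor_mem : ∀ X Y Z, IsDerivedTensor X Y Z → D Y → D Z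
  isDefinable : IsDefinable.{u} D

/-- Thick `⊗`-ideals of the category of compact objects of `D(R)`. -/
structure IsThickTensorIdealOfCompacts
    (S : ObjectProperty (DerivedCategory (ModuleCat.{u} R))) : Prop where
  isCompactObject : ∀ X, S X → IsCompactObject.{u} X
  isThick : IsThick S
  tensor_mem : ∀ X Y Z, IsCompactObject.{u} X → IsDerivedTensor X Y Z → S Y → S Z

/-- A subcategory of `D(R)` is compactly generated, as a definable `⊗`-ideal, if it is the right
orthogonal of a thick `⊗`-ideal of compact objects. -/
def IsCompactlyGenerated (D : ObjectProperty (DerivedCategory (ModuleCat.{u} R))) : Prop :=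
  ∃ S : ObjectProperty (DerivedCategory (ModuleCat.{u} R)),
    IsThickTensorIdealOfCompacts S ∧ D = perp S

/-- The total cohomology module `H^*(X) = ⨁ n, H^n(X)`. -/
def totalCohomology (X : DerivedCategory (ModuleCat.{u} R)) : ModuleCat.{u} R :=
  ModuleCat.of R (DirectSum ℤ fun n =>
    ((DerivedCategory.homologyFunctor (ModuleCat.{u} R) n).obj X : ModuleCat.{u} R))

/-- `X ∈ D` implies `H^*(X) ∈ D`, where modules are viewed as complexes in degree `0`. -/
def IsClosedUnderCohomology (D : ObjectProperty (DerivedCategory (ModuleCat.{u} R))) : Prop :=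
  ∀ X, D X → D ((DerivedCategory.singleFunctor (ModuleCat.{u} R) 0).obj (totalCohomology X))

variable (R) in
/-- The Restricted Telescope Conjecture for `D(R)`. -/
def RestrictedTelescopeConjecture : Prop :=
  ∀ D : ObjectProperty (DerivedCategory (ModuleCat.{u} R)),
    IsDefinableTensorIdeal D → IsClosedUnderCohomology D → IsCompactlyGenerated D

/-- The subcategory of `D(R)` attached to `R → S`: the objects `X` whose cohomology `H^*(X)` lies
in the essential image of the restriction functor from `S`-modules to `R`-modules. -/
def cohomologyFrom (R S : Type u) [CommRing R] [Ring S] [Algebra R S]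
    [HasDerivedCategory.{w} (ModuleCat.{u} R)] :
    ObjectProperty (DerivedCategory (ModuleCat.{u} R)) :=
  fun X => (ModuleCat.restrictScalars.{u} (algebraMap R S)).essImage (totalCohomology X)

/-- `R → S` is a pseudoflat ring epimorphism: it is an epimorphism in the category of rings and
`Tor₁(S, S) = 0` over `R`. -/
def IsPseudoflatEpi (R S : Type u) [CommRing R] [Ring S] [Algebra R S] : Prop :=
  Epi (RingCat.ofHom (algebraMap R S)) ∧
    IsZero (((Tor (ModuleCat.{u} R) 1).obj (ModuleCat.of R S)).obj (ModuleCat.of R S))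

end DerivedTelescope

end

/-! Write D for the objects whose cohomology is killed by `I`; this is the subcategory in question
(`cohomologyFrom_quotient_eq`). Morphisms from a shift of `R` are cohomology classes, so D is cut
out by the multiplications by elements of `I` on the shifts of `R`, which are compact: D is
definable. In a long exact sequence a term between two modules killed by `I` is killed by `I * I =
I`, so D is closed under extensions.

The ⊗-ideal property rests on `IsCohomologyKilledBy.smul_hom`: if `I` kills the cohomology of `W`,
it kills Hom(X, W) for every X. A map in I·Hom(X, W) vanishes on all shifts of `R` over X, so it
extends along a map X ⟶ X₁ that is zero in cohomology; idempotence lets the extension be chosen in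
I·Hom(X₁, W), and the process repeats. The homotopy colimit of the resulting tower is zero, hence so
is the map. The adjunction between P ⊗ - and Hom(-, J), with J injective, carries this over to the
cohomology of P ⊗ N.

Suppose D is the right orthogonal of a class S of compact objects. All shifts of the residue field
lie in D, so objects of S have no nonzero maps to them. A compact object is bounded above with
finitely generated top cohomology, so Nakayama makes it zero
(`IsCompactObject.isZero_of_forall_residueField`). Then D is everything, contains `R`, and I = 0, a
contradiction; thus D refutes the conjecture.

Finally Tor₁(R/I, R/I) = I/I² = 0, whereas flatness of R/I over a local ring forces I = 0 by the
equational criterion. -/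

namespace DerivedCategory

/-! ### Morphisms out of a projective object placed in one degree. -/

section Abelian

universe v

variable {C : Type u} [Category.{v} C] [Abelian C] [HasDerivedCategory.{w} C]

/-- The object `P` of an abelian category, as an object of the derived category concentrated in
degree `n`. -/
noncomputable abbrev sgl (n : ℤ) (P : C) : DerivedCategory C :=
  Q.obj ((HomologicalComplex.single C (ComplexShape.up ℤ) n).obj P)

/-- The cohomology of a complex, computed in the derived category. -/
noncomputable def homologyQIso (K : CochainComplex C ℤ) (n : ℤ) :
    (homologyFunctor C n).obj (Q.obj K) ≅ K.homology n :=
  (homologyFunctorFactors C n).app K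

lemma homologyQIso_hom_naturality {K L : CochainComplex C ℤ} (f : K ⟶ L) (n : ℤ) :
    (homologyFunctor C n).map (Q.map f) ≫ (homologyQIso L n).hom =
      (homologyQIso K n).hom ≫ HomologicalComplex.homologyMap f n :=
  homologyFunctorFactors_hom_naturality f n

lemma homologyQIso_inv_naturality {K L : CochainComplex C ℤ} (f : K ⟶ L) (n : ℤ) :
    (homologyQIso K n).inv ≫ (homologyFunctor C n).map (Q.map f) =
      HomologicalComplex.homologyMap f n ≫ (homologyQIso L n).inv := by
  rw [Iso.inv_comp_eq, ← reassoc_of% (homologyQIso_hom_naturality f n), Iso.hom_inv_id,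
    Category.comp_id]

/-- The canonical isomorphism between an object and the cohomology of the corresponding complex
concentrated in a single degree. -/
noncomputable def homologySglIso (n : ℤ) (P : C) :
    (homologyFunctor C n).obj (sgl n P) ≅ P :=
  homologyQIso _ n ≪≫ HomologicalComplex.singleObjHomologySelfIso (ComplexShape.up ℤ) n P

instance isKProjective_single (n : ℤ) (P : C) [Projective P] :
    CochainComplex.IsKProjective
      ((HomologicalComplex.single C (ComplexShape.up ℤ) n).obj P) := by
  have : ((CochainComplex.singleFunctor C n).obj P).IsStrictlyLE n := inferInstance
  have (m : ℤ) : Projective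
      (((HomologicalComplex.single C (ComplexShape.up ℤ) n).obj P).X m) := by
    by_cases h : m = n
    · exact Projective.of_iso
        (HomologicalComplex.singleObjXIsoOfEq (ComplexShape.up ℤ) n P m h).symm inferInstance
    · exact ⟨fun f e he => ⟨0, (HomologicalComplex.isZero_single_obj_X _ _ _ _ h).eq_of_src _ _⟩⟩
  exact CochainComplex.isKProjective_of_projective _ n

lemma Q_map_surjective_of_isKProjective (K L : CochainComplex C ℤ) [K.IsKProjective] :
    Function.Surjective (fun f : K ⟶ L => Q.map f) := by
  intro f
  obtain ⟨g, hg⟩ := (CochainComplex.IsKProjective.Qh_map_bijective K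
    ((HomotopyCategory.quotient _ _).obj L)).surjective
      ((quotientCompQhIso C).hom.app K ≫ f ≫ (quotientCompQhIso C).inv.app L)
  obtain ⟨g, rfl⟩ := (HomotopyCategory.quotient _ _).map_surjective g
  refine ⟨g, ?_⟩
  have := quotientCompQhIso_hom_naturality g
  dsimp only at this ⊢
  rw [hg] at this
  simpa using this.symm

lemma homotopy_zero_of_Q_map_eq_zero {K L : CochainComplex C ℤ} [K.IsKProjective] (f : K ⟶ L)
    (hf : Q.map f = 0) : Nonempty (Homotopy f 0) := by
  rw [← HomotopyCategory.quotient_map_eq_zero_iff]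
  apply (CochainComplex.IsKProjective.Qh_map_bijective K
    ((HomotopyCategory.quotient _ _).obj L)).injective
  have := quotientCompQhIso_hom_naturality f
  rw [hf, comp_zero] at this
  rw [Functor.map_zero, ← cancel_mono ((quotientCompQhIso C).hom.app L), zero_comp]
  exact this

lemma homologySglIso_inv_comp_map (n : ℤ) (P : C) {K : CochainComplex C ℤ}
    (g : (HomologicalComplex.single C (ComplexShape.up ℤ) n).obj P ⟶ K)
    (φ : P ⟶ K.X n) (hφ : φ ≫ K.d n (n + 1) = 0)
    (hg : (HomologicalComplex.singleObjXSelf _ n P).inv ≫ g.f n = φ) :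
    (homologySglIso n P).inv ≫ (homologyFunctor C n).map (Q.map g) =
      K.liftCycles φ (n + 1) (by simp) hφ ≫ K.homologyπ n ≫ (homologyQIso K n).inv := by
  rw [homologySglIso, Iso.trans_inv, Category.assoc, homologyQIso_inv_naturality,
    ← HomologicalComplex.singleObjCyclesSelfIso_inv_homologyπ,
    Category.assoc, HomologicalComplex.homologyπ_naturality_assoc]
  simp only [← Category.assoc]
  congr 2
  rw [← cancel_mono (K.iCycles n)]
  simp [← hg]

omit [HasDerivedCategory.{w} C] in
open CochainComplex.HomComplex in
lemma nonempty_homotopy_zero_from_single {n : ℤ} {P : C} {K : CochainComplex C ℤ}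
    (g : (CochainComplex.singleFunctor C n).obj P ⟶ K) (ψ : P ⟶ K.X (n - 1))
    (hψ : g.f n = (HomologicalComplex.singleObjXSelf _ n P).hom ≫ ψ ≫ K.d (n - 1) n) :
    Nonempty (Homotopy g 0) := by
  obtain ⟨φ, h⟩ := Cochain.fromSingleMk_surjective (Cochain.ofHom g) n (add_zero n)
  have h2 := Cochain.congr_v h n n (add_zero n)
  rw [Cochain.ofHom_v, hψ] at h2
  have h3 : φ = ψ ≫ K.d (n - 1) n := by
    have := (Cochain.fromSingleMk_v φ (add_zero n)).symm.trans h2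
    exact (cancel_epi (HomologicalComplex.singleObjXSelf (ComplexShape.up ℤ) n P).hom).1 this
  refine ⟨(Cochain.equivHomotopy _ _).symm
    ⟨Cochain.fromSingleMk ψ (by lia : n + -1 = n - 1), ?_⟩⟩
  rw [Cochain.δ_fromSingleMk _ _ _ n (by lia), ← h3, ← h]
  simp

/-- The source is K-projective, so morphisms are represented by chain maps, that is by maps from `P`
to cycles. Projectivity lifts a map `P ⟶ H^n` to cycles, and lifts a map into boundaries to a
null-homotopy. For `P = R` this makes `H^n` corepresentable. -/
lemma sgl_hom_bijective (n : ℤ) (P : C) [Projective P] (X : DerivedCategory C) :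
    Function.Bijective (fun f : sgl n P ⟶ X =>
      (homologySglIso n P).inv ≫ (homologyFunctor C n).map f) := by
  obtain ⟨K, ⟨e⟩⟩ : ∃ K, Nonempty (Q.obj K ≅ X) := ⟨_, ⟨Q.objObjPreimageIso X⟩⟩
  let S := (HomologicalComplex.single C (ComplexShape.up ℤ) n).obj P
  have kzero (g : S ⟶ K)
      (h : (homologySglIso n P).inv ≫ (homologyFunctor C n).map (Q.map g) = 0) :
      Q.map g = 0 := by
    let φ := (HomologicalComplex.singleObjXSelf _ n P).inv ≫ g.f n
    have hφ : φ ≫ K.d n (n + 1) = 0 := by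
      have h0 : S.d n (n + 1) = 0 := HomologicalComplex.single_obj_d _ _ _ _ _
      simp only [φ, Category.assoc, g.comm, h0, zero_comp, comp_zero]
    rw [homologySglIso_inv_comp_map n P g φ hφ rfl, ← Category.assoc,
      Preadditive.IsIso.comp_right_eq_zero,
      HomologicalComplex.liftCycles_comp_homologyπ_eq_zero_iff_up_to_refinements K (n - 1) n
        (n + 1) (by simp) (by simp)] at h
    obtain ⟨A, π, _, x, hx⟩ := h
    -- The refinement `π` is an epimorphism onto a projective, so a section of it removes the
    -- refinement.
    let ψ : P ⟶ K.X (n - 1) := Projective.factorThru (𝟙 P) π ≫ x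
    have hψ : ψ ≫ K.d (n - 1) n = φ := by
      simp only [ψ, Category.assoc, ← hx, Projective.factorThru_comp_assoc, Category.id_comp]
    obtain ⟨hom⟩ := nonempty_homotopy_zero_from_single (n := n) g ψ
      ((Iso.eq_inv_comp _).1 hψ).symm
    exact (Q_map_eq_of_homotopy C hom).trans (Functor.map_zero _ _ _)
  constructor
  · intro f₁ f₂ h
    rw [← sub_eq_zero, ← Preadditive.IsIso.comp_right_eq_zero _ e.inv]
    obtain ⟨g, hg⟩ := Q_map_surjective_of_isKProjective S K ((f₁ - f₂) ≫ e.inv)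
    dsimp only at hg h
    rw [← hg]
    apply kzero
    rw [hg, Functor.map_comp, Functor.map_sub, Preadditive.sub_comp, Preadditive.comp_sub,
      reassoc_of% h, sub_self]
  · intro x
    obtain ⟨z, hz⟩ : ∃ z : P ⟶ K.cycles n, z ≫ K.homologyπ n =
        x ≫ (homologyFunctor C n).map e.inv ≫ (homologyQIso K n).hom :=
      ⟨Projective.factorThru _ _, Projective.factorThru_comp _ _⟩
    refine ⟨Q.map (HomologicalComplex.mkHomFromSingle (z ≫ K.iCycles n) ?_) ≫ e.hom, ?_⟩
    · simp
    · dsimp only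
      rw [Functor.map_comp, ← Category.assoc,
        homologySglIso_inv_comp_map n P _ (z ≫ K.iCycles n) (by simp)]
      · have : K.liftCycles (z ≫ K.iCycles n) (n + 1) (by simp) (by simp) = z := by
          rw [← cancel_mono (K.iCycles n)]; simp
        rw [this, reassoc_of% hz, Iso.hom_inv_id, Category.comp_id, Category.assoc,
          ← Functor.map_comp, Iso.inv_hom_id, CategoryTheory.Functor.map_id, Category.comp_id]
      · simp

end Abelian

end DerivedCategory

/-! ### Truncation of a coproduct to finitely many summands. -/

namespace CategoryTheory.Limits.Cofan

variable {T : Type*} [Category* T] [Preadditive T] {J : Type*} {X : J → T} {c : Cofan X}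

open scoped Classical in
/-- The projections from a coproduct to its summands. -/
noncomputable def proj (hc : IsColimit c) (j : J) : c.pt ⟶ X j :=
  Cofan.IsColimit.desc hc (fun i => if h : i = j then eqToHom (by rw [h]) else 0)

lemma inj_proj_self (hc : IsColimit c) (j : J) : c.inj j ≫ proj hc j = 𝟙 _ := by
  simp [proj]

lemma inj_proj_self_assoc (hc : IsColimit c) (j : J) {Z : T} (h : X j ⟶ Z) :
    c.inj j ≫ proj hc j ≫ h = h := by
  rw [← Category.assoc, inj_proj_self, Category.id_comp]

lemma inj_proj_of_ne (hc : IsColimit c) {i j : J} (h : i ≠ j) : c.inj i ≫ proj hc j = 0 := by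
  simp [proj, h]

lemma inj_proj_of_ne_assoc (hc : IsColimit c) {i j : J} (h : i ≠ j) {Z : T} (f : X j ⟶ Z) :
    c.inj i ≫ proj hc j ≫ f = 0 := by
  rw [← Category.assoc, inj_proj_of_ne hc h, zero_comp]

/-- The idempotent endomorphism of a coproduct given by a finite set of summands. -/
noncomputable def trunc (hc : IsColimit c) (s : Finset J) : c.pt ⟶ c.pt :=
  ∑ j ∈ s, proj hc j ≫ c.inj j

lemma inj_trunc (hc : IsColimit c) {s : Finset J} {j : J} (hj : j ∈ s) :
    c.inj j ≫ trunc hc s = c.inj j := by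
  rw [trunc, Preadditive.comp_sum, Finset.sum_eq_single j, inj_proj_self_assoc]
  · exact fun i _ hi => by rw [inj_proj_of_ne_assoc hc hi.symm]
  · exact fun h => (h hj).elim

lemma trunc_trunc (hc : IsColimit c) {s t : Finset J} (h : s ⊆ t) :
    trunc hc s ≫ trunc hc t = trunc hc s := by
  conv_lhs => rw [trunc, Preadditive.sum_comp]
  exact Finset.sum_congr rfl fun j hj => by rw [Category.assoc, inj_trunc hc (h hj)]

lemma trunc_proj_of_notMem (hc : IsColimit c) {s : Finset J} {j : J} (hj : j ∉ s) :
    trunc hc s ≫ proj hc j = 0 := by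
  rw [trunc, Preadditive.sum_comp]
  refine Finset.sum_eq_zero fun i hi => ?_
  rw [Category.assoc, inj_proj_of_ne hc (by rintro rfl; exact hj hi), comp_zero]

end CategoryTheory.Limits.Cofan

/-! ### Compactness expressed through finite truncations. -/

namespace DerivedTelescope

open Cofan

section Compact

variable {T : Type*} [Category.{w} T] [Preadditive T]

/-- The finitely supported maps form a subgroup `N`. The quotient map by `N` vanishes on every
summand, hence vanishes because Hom(S, -) preserves the coproduct. No explicit model of a coproduct
of abelian groups enters. -/
lemma IsCompactObject.exists_comp_trunc_eq {S : T} (hS : IsCompactObject.{u} S) {J : Type u}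
    {X : J → T} {c : Cofan X} (hc : IsColimit c) (f : S ⟶ c.pt) :
    ∃ s, f ≫ trunc hc s = f := by
  classical
  let F := preadditiveCoyoneda.obj (Opposite.op S)
  have := hS J
  have hF : IsColimit (F.mapCocone c) := isColimitOfPreserves F hc
  let N : AddSubgroup (S ⟶ c.pt) :=
    { carrier := {f | ∃ s, f ≫ trunc hc s = f}
      zero_mem' := ⟨∅, zero_comp⟩
      neg_mem' := by
        rintro f ⟨s, hs⟩
        exact ⟨s, by rw [Preadditive.neg_comp, hs]⟩
      add_mem' := by
        rintro f g ⟨s, hs⟩ ⟨t, ht⟩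
        refine ⟨s ∪ t, ?_⟩
        rw [Preadditive.add_comp]
        congr 1
        · rw [← hs, Category.assoc, trunc_trunc hc Finset.subset_union_left]
        · rw [← ht, Category.assoc, trunc_trunc hc Finset.subset_union_right] }
  let q : (F.mapCocone c).pt ⟶ AddCommGrpCat.of ((S ⟶ c.pt) ⧸ N) :=
    AddCommGrpCat.ofHom (QuotientAddGroup.mk' N)
  have hq : q = 0 := by
    refine hF.hom_ext fun ⟨j⟩ => ?_
    have hN (g : S ⟶ X j) : g ≫ c.inj j ∈ N :=
      ⟨{j}, by rw [Category.assoc, inj_trunc hc (Finset.mem_singleton_self j)]⟩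
    ext g
    exact (QuotientAddGroup.eq_zero_iff (N := N) _).2 (hN g)
  exact (QuotientAddGroup.eq_zero_iff (N := N) f).1 (ConcreteCategory.congr_hom hq f)

/-- Finite support turns the sum over all projections into a finite sum, which defines the map out
of Hom(S, ∐ X) required by the universal property. -/
lemma isCompactObject_of_exists_comp_trunc_eq {S : T}
    (hS : ∀ ⦃J : Type u⦄ ⦃X : J → T⦄ ⦃c : Cofan X⦄ (hc : IsColimit c) (f : S ⟶ c.pt),
      ∃ s, f ≫ trunc hc s = f) : IsCompactObject.{u} S := by
  intro J
  let F := preadditiveCoyoneda.obj (Opposite.op S)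
  suffices ∀ X : J → T, PreservesColimit (Discrete.functor X) F from
    ⟨fun {K} => by
      have := this (fun j => K.obj ⟨j⟩)
      exact preservesColimit_of_iso_diagram F (Discrete.natIsoFunctor (F := K)).symm⟩
  intro X
  refine ⟨fun {c} hc => ⟨?_⟩⟩
  change Cofan X at c
  let σ (s : Cocone (Discrete.functor X ⋙ F)) (j : J) : (S ⟶ X j) →+ s.pt := (s.ι.app ⟨j⟩).hom
  have hsupp (s : Cocone (Discrete.functor X ⋙ F)) (f : S ⟶ c.pt) (t : Finset J)
      (ht : f ≫ trunc hc t = f) :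
      (Function.support fun j => σ s j (f ≫ proj hc j)) ⊆ t := by
    intro j hj
    by_contra hj'
    refine hj ?_
    dsimp only
    rw [← ht, Category.assoc, trunc_proj_of_notMem hc hj', comp_zero, map_zero]
  have hfin (s : Cocone (Discrete.functor X ⋙ F)) (f : S ⟶ c.pt) :
      (Function.support fun j => σ s j (f ≫ proj hc j)).Finite := by
    obtain ⟨t, ht⟩ := hS hc f
    exact t.finite_toSet.subset (hsupp s f t ht)
  let d (s : Cocone (Discrete.functor X ⋙ F)) : (S ⟶ c.pt) →+ s.pt :=
    { toFun := fun f => ∑ᶠ j, σ s j (f ≫ proj hc j)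
      map_zero' := by simp
      map_add' := fun f g => by
        rw [← finsum_add_distrib (hfin s f) (hfin s g)]
        simp }
  have hd (s : Cocone (Discrete.functor X ⋙ F)) (j : J) (g : S ⟶ X j) :
      d s (g ≫ c.inj j) = σ s j g := by
    change ∑ᶠ i, σ s i ((g ≫ c.inj j) ≫ proj hc i) = σ s j g
    rw [finsum_eq_single _ j, Category.assoc, inj_proj_self, Category.comp_id]
    intro i hi
    rw [Category.assoc, inj_proj_of_ne hc hi.symm, comp_zero, map_zero]
  exact
    { desc := fun s => AddCommGrpCat.ofHom (d s)
      fac := by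
        rintro s ⟨j⟩
        ext g
        exact hd s j g
      uniq := by
        intro s m hm
        ext f
        let m' : (S ⟶ c.pt) →+ s.pt := m.hom
        let f' : S ⟶ c.pt := f
        change m' f' = d s f'
        have hm' (j : J) (g : S ⟶ X j) : m' (g ≫ c.inj j) = σ s j g :=
          ConcreteCategory.congr_hom (hm ⟨j⟩) g
        obtain ⟨t, ht⟩ := hS hc f'
        rw [← ht, trunc, Preadditive.comp_sum, map_sum, map_sum]
        refine Finset.sum_congr rfl fun j _ => ?_
        rw [← Category.assoc, hm', hd] }

end Compact

end DerivedTelescope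

/-! ### Coproducts in the derived category and their cohomology. -/

namespace DerivedTelescope

open Cofan

section Modules

variable {R : Type u} [CommRing R]

lemma exists_trunc_eq_of_modules {T : Type*} [Category* T] [Preadditive T]
    (F : T ⥤ ModuleCat.{u} R) [F.Additive] {J : Type u} {X : J → T} {c : Cofan X}
    (hc : IsColimit c) (hF : IsColimit (F.mapCocone c)) (x : F.obj c.pt) :
    ∃ s, F.map (trunc hc s) x = x := by
  classical
  let N : Submodule R (F.obj c.pt) :=
    { carrier := {x | ∃ s, F.map (trunc hc s) x = x}
      zero_mem' := ⟨∅, map_zero _⟩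
      smul_mem' := by
        rintro r x ⟨s, hs⟩
        exact ⟨s, by rw [map_smul, hs]⟩
      add_mem' := by
        have key {s t : Finset J} (h : s ⊆ t) {x : F.obj c.pt} (hs : F.map (trunc hc s) x = x) :
            F.map (trunc hc t) x = x := by
          conv_lhs => rw [← hs, ← ModuleCat.comp_apply, ← F.map_comp, trunc_trunc hc h, hs]
        rintro f g ⟨s, hs⟩ ⟨t, ht⟩
        refine ⟨s ∪ t, ?_⟩
        rw [map_add, key Finset.subset_union_left hs, key Finset.subset_union_right ht] }
  let q : (F.mapCocone c).pt ⟶ ModuleCat.of R ((F.obj c.pt) ⧸ N) := ModuleCat.ofHom N.mkQ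
  have hq : q = 0 := by
    refine hF.hom_ext fun ⟨j⟩ => ?_
    have hN (y : F.obj (X j)) : F.map (c.inj j) y ∈ N :=
      ⟨{j}, by rw [← ModuleCat.comp_apply, ← F.map_comp,
        inj_trunc hc (Finset.mem_singleton_self j)]⟩
    ext y
    exact (Submodule.Quotient.mk_eq_zero N).2 (hN y)
  exact (Submodule.Quotient.mk_eq_zero N).1 (ConcreteCategory.congr_hom hq x)

lemma exists_homologyMap_trunc_eq {J : Type u} {K : J → CochainComplex (ModuleCat.{u} R) ℤ}
    {c : Cofan K} (hc : IsColimit c) (n : ℤ) (x : c.pt.homology n) :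
    ∃ s, HomologicalComplex.homologyMap (trunc hc s) n x = x := by
  obtain ⟨z, rfl⟩ := (ModuleCat.epi_iff_surjective (c.pt.homologyπ n)).1 inferInstance x
  obtain ⟨s, hs⟩ := exists_trunc_eq_of_modules
    (HomologicalComplex.eval (ModuleCat.{u} R) (ComplexShape.up ℤ) n) hc
      (isColimitOfPreserves _ hc) (c.pt.iCycles n z)
  refine ⟨s, ?_⟩
  rw [← ModuleCat.comp_apply, HomologicalComplex.homologyπ_naturality, ModuleCat.comp_apply]
  congr 1
  apply (ModuleCat.mono_iff_injective (c.pt.iCycles n)).1 inferInstance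
  rw [← ModuleCat.comp_apply, HomologicalComplex.cyclesMap_i, ModuleCat.comp_apply]
  exact hs

end Modules

section Derived

open DerivedCategory

variable {R : Type u} [CommRing R] [HasDerivedCategory.{w} (ModuleCat.{u} R)]

omit [HasDerivedCategory.{w} (ModuleCat.{u} R)] in
lemma homologyMap_smul {K L : CochainComplex (ModuleCat.{u} R) ℤ} (f : K ⟶ L) (r : R) (n : ℤ) :
    HomologicalComplex.homologyMap (r • f) n = r • HomologicalComplex.homologyMap f n :=
  ShortComplex.homologyMap_smul
    ((HomologicalComplex.shortComplexFunctor (ModuleCat.{u} R) (ComplexShape.up ℤ) n).map f) r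

instance homologyFunctor_linear (n : ℤ) :
    (homologyFunctor (ModuleCat.{u} R) n).Linear R where
  map_smul {X Y} f r := by
    obtain ⟨K, ⟨e⟩⟩ : ∃ K, Nonempty (Q.obj K ≅ X) := ⟨_, ⟨Q.objObjPreimageIso X⟩⟩
    have h : r • f = e.inv ≫ Q.map (r • 𝟙 K) ≫ e.hom ≫ f := by
      rw [Functor.map_smul]
      simp
    have h2 : (homologyFunctor (ModuleCat.{u} R) n).map (Q.map (r • 𝟙 K)) = r • 𝟙 _ := by
      rw [← cancel_mono (homologyQIso K n).hom, homologyQIso_hom_naturality,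
        homologyMap_smul]
      simp
    rw [h, Functor.map_comp, Functor.map_comp, h2]
    simp [← Functor.map_comp]

lemma exists_homologyFunctor_map_Q_trunc_eq {J : Type u}
    {K : J → CochainComplex (ModuleCat.{u} R) ℤ} {c : Cofan K} (hc : IsColimit c) (n : ℤ)
    (x : (homologyFunctor (ModuleCat.{u} R) n).obj (Q.obj c.pt)) :
    ∃ s, (homologyFunctor (ModuleCat.{u} R) n).map (Q.map (trunc hc s)) x = x := by
  obtain ⟨s, hs⟩ := exists_homologyMap_trunc_eq hc n ((homologyQIso c.pt n).hom x)
  refine ⟨s, ?_⟩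
  apply (ModuleCat.mono_iff_injective (homologyQIso c.pt n).hom).1 inferInstance
  rw [← ModuleCat.comp_apply, homologyQIso_hom_naturality, ModuleCat.comp_apply, hs]

/-- Localization preserves coproducts: a coproduct of quasi-isomorphisms is a quasi-isomorphism, so
families of right fractions can be assembled. Uniqueness follows because a cohomology class of a
coproduct lives on finitely many summands. -/
lemma isColimit_Q_mapCocone {J : Type u} {K : J → CochainComplex (ModuleCat.{u} R) ℤ}
    {c : Cofan K} (hc : IsColimit c) :
    Nonempty (IsColimit (Cofan.mk (Q.obj c.pt) (fun j => Q.map (c.inj j)))) := by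
  have lift {Y : DerivedCategory (ModuleCat.{u} R)} (f : ∀ j, Q.obj (K j) ⟶ Y) :
      ∃ g : Q.obj c.pt ⟶ Y, ∀ j, Q.map (c.inj j) ≫ g = f j := by
    obtain ⟨L, ⟨e⟩⟩ : ∃ K, Nonempty (Q.obj K ≅ Y) := ⟨_, ⟨Q.objObjPreimageIso Y⟩⟩
    choose K' s hs g hg using fun j => right_fac (f j ≫ e.inv)
    obtain ⟨c', ⟨hc'⟩⟩ : ∃ c' : Cofan K', Nonempty (IsColimit c') := ⟨_, ⟨coproductIsCoproduct K'⟩⟩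
    let S : c'.pt ⟶ c.pt := Cofan.IsColimit.desc hc' (fun j => s j ≫ c.inj j)
    let G : c'.pt ⟶ L := Cofan.IsColimit.desc hc' g
    have hS (j : J) : c'.inj j ≫ S = s j ≫ c.inj j := Cofan.IsColimit.fac hc' _ j
    have hG (j : J) : c'.inj j ≫ G = g j := Cofan.IsColimit.fac hc' _ j
    have hS' (j : J) : proj hc' j ≫ s j = S ≫ proj hc j := by
      refine Cofan.IsColimit.hom_ext hc' _ _ fun i => ?_
      rw [reassoc_of% hS]
      by_cases h : i = j
      · subst h
        rw [inj_proj_self, inj_proj_self_assoc, Category.comp_id]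
      · rw [inj_proj_of_ne hc h, inj_proj_of_ne_assoc hc' h, comp_zero]
    have hSQ : QuasiIso S := by
      rw [quasiIso_iff]
      intro n
      rw [quasiIsoAt_iff_isIso_homologyMap]
      let H := HomologicalComplex.homologyFunctor (ModuleCat.{u} R) (ComplexShape.up ℤ) n
      have hsn (j : J) : IsIso (H.map (s j)) := by
        have : QuasiIso (s j) := (isIso_Q_map_iff_quasiIso _ (s j)).1 (hs j)
        exact inferInstanceAs (IsIso (HomologicalComplex.homologyMap (s j) n))
      -- An inverse of `H.map S` on the summands in `t`; each class is fixed by some truncation, so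
      -- these partial inverses suffice.
      let W (t : Finset J) : H.obj c.pt ⟶ H.obj c'.pt :=
        ∑ j ∈ t, H.map (proj hc j) ≫ inv (H.map (s j)) ≫ H.map (c'.inj j)
      have hW (t : Finset J) : W t ≫ H.map S = H.map (trunc hc t) := by
        simp only [W, trunc, Preadditive.sum_comp, Functor.map_sum, Category.assoc,
          ← H.map_comp, hS]
        simp only [H.map_comp, IsIso.inv_hom_id_assoc]
      have hW' (t : Finset J) : H.map S ≫ W t = H.map (trunc hc' t) := by
        simp only [W, trunc, Preadditive.comp_sum, Functor.map_sum,
          ← H.map_comp_assoc, ← hS']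
        simp only [H.map_comp, IsIso.hom_inv_id_assoc, Category.assoc]
      rw [ConcreteCategory.isIso_iff_bijective]
      constructor
      · rw [injective_iff_map_eq_zero]
        intro x hx
        obtain ⟨t, ht⟩ := exists_homologyMap_trunc_eq hc' n x
        have := ConcreteCategory.congr_hom (hW' t) x
        exact ht.symm.trans (this.symm.trans ((congr_arg (W t).hom hx).trans (map_zero (W t).hom)))
      · intro y
        obtain ⟨t, ht⟩ := exists_homologyMap_trunc_eq hc n y
        have := ConcreteCategory.congr_hom (hW t) y
        exact ⟨_, this.trans ht⟩
    have : IsIso (Q.map S) := (isIso_Q_map_iff_quasiIso _ S).2 hSQ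
    refine ⟨inv (Q.map S) ≫ Q.map G ≫ e.hom, fun j => ?_⟩
    have : Q.map (c.inj j) ≫ inv (Q.map S) = inv (Q.map (s j)) ≫ Q.map (c'.inj j) := by
      rw [IsIso.comp_inv_eq, Category.assoc, ← Q.map_comp, hS, Q.map_comp, IsIso.inv_hom_id_assoc]
    rw [reassoc_of% this, ← Q.map_comp_assoc, hG, ← Category.assoc, ← hg, Category.assoc,
      Iso.inv_hom_id, Category.comp_id]
  have ext_zero {Y : DerivedCategory (ModuleCat.{u} R)} (f : Q.obj c.pt ⟶ Y)
      (hf : ∀ j, Q.map (c.inj j) ≫ f = 0) : f = 0 := by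
    -- The inclusions lift to the fibre `F` of `f` and assemble to `g`. Since `g ≫ i` is the
    -- identity in cohomology it is invertible, while `i ≫ f = 0`, so `f = 0`.
    obtain ⟨F, i, δ, hT⟩ := distinguished_cocone_triangle₁ f
    have hl (j : J) : ∃ l : Q.obj (K j) ⟶ F, Q.map (c.inj j) = l ≫ i :=
      Triangle.coyoneda_exact₂ _ hT (Q.map (c.inj j)) (hf j)
    choose l hl using hl
    obtain ⟨g, hg⟩ := lift l
    have hgi (j : J) : Q.map (c.inj j) ≫ g ≫ i = Q.map (c.inj j) := by
      rw [reassoc_of% hg]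
      exact (hl j).symm
    have : IsIso (g ≫ i) := by
      rw [DerivedCategory.isIso_iff]
      intro n
      suffices (homologyFunctor (ModuleCat.{u} R) n).map (g ≫ i) = 𝟙 _ by
        rw [this]; infer_instance
      ext x
      obtain ⟨t, ht⟩ := exists_homologyFunctor_map_Q_trunc_eq hc n x
      have h : Q.map (trunc hc t) ≫ g ≫ i = Q.map (trunc hc t) := by
        simp only [trunc, Functor.map_sum, Functor.map_comp, Preadditive.sum_comp, Category.assoc,
          hgi]
      rw [← ht, ← ModuleCat.comp_apply, ← Functor.map_comp, h]
      rfl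
    have hif : i ≫ f = 0 := comp_distTriang_mor_zero₁₂ _ hT
    rw [← cancel_epi (g ≫ i), Category.assoc, hif, comp_zero, comp_zero]
  choose D hD using fun (s : Cofan fun j => Q.obj (K j)) => lift s.inj
  refine ⟨Cofan.IsColimit.mk _ D hD fun s m hm => ?_⟩
  rw [← sub_eq_zero]
  refine ext_zero _ fun j => ?_
  rw [Preadditive.comp_sub, sub_eq_zero]
  exact (hm j).trans (hD s j).symm

lemma exists_isColimit_cofan {J : Type u} (X : J → DerivedCategory (ModuleCat.{u} R)) :
    ∃ (K : J → CochainComplex (ModuleCat.{u} R) ℤ) (e : ∀ j, Q.obj (K j) ≅ X j),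
      Nonempty (IsColimit (Cofan.mk (Q.obj (∐ K)) (fun j => (e j).inv ≫ Q.map (Sigma.ι K j)))) := by
  let K (j : J) := Q.objPreimage (X j)
  let e (j : J) : Q.obj (K j) ≅ X j := Q.objObjPreimageIso (X j)
  obtain ⟨h⟩ := isColimit_Q_mapCocone (coproductIsCoproduct K)
  refine ⟨K, e, ⟨Cofan.IsColimit.mk _
    (fun s => Cofan.IsColimit.desc h fun j => (e j).hom ≫ s.inj j) (fun s j => ?_)
      fun s m hm => ?_⟩⟩
  · have := Cofan.IsColimit.fac h (fun j => (e j).hom ≫ s.inj j) j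
    refine (Category.assoc _ _ _).trans ((Iso.inv_comp_eq _).2 ?_)
    exact this
  · refine Cofan.IsColimit.hom_ext h _ _ fun j => ?_
    rw [Cofan.IsColimit.fac, ← hm j]
    exact ((Category.assoc _ _ _).symm.trans (Iso.hom_inv_id_assoc _ _ =≫ m)).symm

instance hasCoproducts : HasCoproducts.{u} (DerivedCategory (ModuleCat.{u} R)) := fun J =>
  ⟨fun K => by
    obtain ⟨_, _, ⟨hc⟩⟩ := exists_isColimit_cofan fun j => K.obj ⟨j⟩
    have : HasColimit (Discrete.functor (K.obj ∘ Discrete.mk)) := ⟨⟨_, hc⟩⟩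
    exact hasColimit_of_iso (Discrete.natIsoFunctor (F := K))⟩

lemma exists_homologyFunctor_map_trunc_eq {J : Type u}
    {X : J → DerivedCategory (ModuleCat.{u} R)} {c : Cofan X} (hc : IsColimit c) (n : ℤ)
    (x : (homologyFunctor (ModuleCat.{u} R) n).obj c.pt) :
    ∃ s, (homologyFunctor (ModuleCat.{u} R) n).map (trunc hc s) x = x := by
  obtain ⟨K, e, ⟨h⟩⟩ := exists_isColimit_cofan X
  let φ : Q.obj (∐ K) ≅ c.pt := IsColimit.coconePointUniqueUpToIso h hc
  have hφ (j : J) : Q.map (Sigma.ι K j) ≫ φ.hom = (e j).hom ≫ c.inj j := by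
    have := IsColimit.comp_coconePointUniqueUpToIso_hom h hc ⟨j⟩
    rw [← Iso.inv_comp_eq, ← Category.assoc]
    exact this
  obtain ⟨s, hs⟩ := exists_homologyFunctor_map_Q_trunc_eq (coproductIsCoproduct K) n
    ((homologyFunctor (ModuleCat.{u} R) n).map φ.inv x)
  have key : Q.map (trunc (coproductIsCoproduct K) s) ≫ φ.hom ≫ trunc hc s =
      Q.map (trunc (coproductIsCoproduct K) s) ≫ φ.hom := by
    conv_lhs => rw [trunc]
    conv_rhs => rw [trunc]
    simp only [Functor.map_sum, Functor.map_comp, Preadditive.sum_comp, Category.assoc]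
    refine Finset.sum_congr rfl fun j hj => ?_
    have hφ' : Q.map ((Cofan.mk (∐ K) (Sigma.ι K)).inj j) ≫ φ.hom = (e j).hom ≫ c.inj j := hφ j
    rw [reassoc_of% hφ', hφ', inj_trunc hc hj]
  have hx : x = (homologyFunctor (ModuleCat.{u} R) n).map
      (Q.map (trunc (coproductIsCoproduct K) s) ≫ φ.hom)
        ((homologyFunctor (ModuleCat.{u} R) n).map φ.inv x) := by
    rw [Functor.map_comp, ModuleCat.comp_apply]
    refine Eq.trans ?_ (congr_arg _ hs.symm)
    rw [← ModuleCat.comp_apply, ← Functor.map_comp, Iso.inv_hom_id]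
    simp
  refine ⟨s, ?_⟩
  conv_lhs => rw [hx, ← ModuleCat.comp_apply, ← Functor.map_comp, Category.assoc, key]
  exact hx.symm

variable (R) in
lemma isCompactObject_sgl (n : ℤ) : IsCompactObject.{u} (sgl n (ModuleCat.of R R)) := by
  refine isCompactObject_of_exists_comp_trunc_eq fun J X c hc f => ?_
  obtain ⟨s, hs⟩ := exists_homologyFunctor_map_trunc_eq hc n
    (((homologySglIso n (ModuleCat.of R R)).inv ≫ (homologyFunctor _ n).map f) (1 : R))
  refine ⟨s, (sgl_hom_bijective n (ModuleCat.of R R) c.pt).injective ?_⟩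
  ext
  rw [Functor.map_comp]
  exact hs

end Derived

end DerivedTelescope

/-! ### Sequences with vanishing homotopy colimit. -/

namespace DerivedTelescope

open Cofan DerivedCategory

variable {R : Type u} [CommRing R] [HasDerivedCategory.{w} (ModuleCat.{u} R)]

section Telescope

variable {X : ℕ → DerivedCategory (ModuleCat.{u} R)} (φ : ∀ k, X k ⟶ X (k + 1))
  {c : Cofan fun k : ULift.{u} ℕ => X k.down} (hc : IsColimit c)

/-- The endomorphism of the coproduct of a sequence induced by the transition maps. -/
noncomputable def telescopeShift : c.pt ⟶ c.pt :=
  Cofan.IsColimit.desc hc fun k => φ k.down ≫ c.inj ⟨k.down + 1⟩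

lemma inj_telescopeShift (k : ℕ) :
    c.inj ⟨k⟩ ≫ telescopeShift φ hc = φ k ≫ c.inj ⟨k + 1⟩ :=
  Cofan.IsColimit.fac hc _ _

lemma inj_telescopeShift_assoc (k : ℕ) {Z : DerivedCategory (ModuleCat.{u} R)} (h : c.pt ⟶ Z) :
    c.inj ⟨k⟩ ≫ telescopeShift φ hc ≫ h = φ k ≫ c.inj ⟨k + 1⟩ ≫ h := by
  rw [← Category.assoc, inj_telescopeShift, Category.assoc]

lemma exists_inj_telescopeShift_pow (N k : ℕ) :
    ∃ ψ : X k ⟶ X (k + N), c.inj ⟨k⟩ ≫ (End.of (telescopeShift φ hc) ^ N).asHom = ψ ≫ c.inj ⟨k + N⟩ := by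
  induction N with
  | zero => exact ⟨𝟙 _, (Category.comp_id _).trans (Category.id_comp _).symm⟩
  | succ N ih =>
    obtain ⟨ψ, hψ⟩ := ih
    refine ⟨ψ ≫ φ (k + N), ?_⟩
    rw [pow_succ', End.mul_def, ← Category.assoc, hψ, Category.assoc, inj_telescopeShift,
      Category.assoc]
    rfl

lemma homologyFunctor_map_eq_zero_of_inj {J : Type u} {X : J → DerivedCategory (ModuleCat.{u} R)}
    {c : Cofan X} (hc : IsColimit c) {Y : DerivedCategory (ModuleCat.{u} R)} (f : c.pt ⟶ Y) (n : ℤ)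
    (hf : ∀ j, (homologyFunctor _ n).map (c.inj j ≫ f) = 0) :
    (homologyFunctor _ n).map f = 0 := by
  ext x
  obtain ⟨s, hs⟩ := exists_homologyFunctor_map_trunc_eq hc n x
  have : (homologyFunctor _ n).map (trunc hc s ≫ f) = 0 := by
    rw [trunc, Preadditive.sum_comp, Functor.map_sum]
    refine Finset.sum_eq_zero fun j _ => ?_
    rw [Category.assoc, Functor.map_comp, hf, comp_zero]
  rw [← hs, ← ModuleCat.comp_apply, ← Functor.map_comp, this]
  simp

/-- The shift is nilpotent on each cohomology module, so one minus it is invertible there. The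
exponent may depend on the degree because isomorphisms are detected degree by degree. -/
lemma isIso_one_sub_telescopeShift (h : ∀ m : ℤ, ∃ N : ℕ, ∀ k (ψ : X k ⟶ X (k + N)),
      c.inj ⟨k⟩ ≫ (End.of (telescopeShift φ hc) ^ N).asHom = ψ ≫ c.inj ⟨k + N⟩ →
      (homologyFunctor _ m).map (ψ ≫ c.inj ⟨k + N⟩) = 0) :
    IsIso (𝟙 c.pt - telescopeShift φ hc) := by
  rw [DerivedCategory.isIso_iff]
  intro m
  obtain ⟨N, hN⟩ := h m
  let H := homologyFunctor (ModuleCat.{u} R) m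
  have hpow : H.map (End.of (telescopeShift φ hc) ^ N).asHom = 0 := by
    refine homologyFunctor_map_eq_zero_of_inj hc _ _ fun ⟨k⟩ => ?_
    obtain ⟨ψ, hψ⟩ := exists_inj_telescopeShift_pow φ hc N k
    rw [hψ]
    exact hN k ψ hψ
  have hnil : IsNilpotent (H.mapEnd c.pt (End.of (telescopeShift φ hc))) :=
    ⟨N, by rw [← map_pow]; exact hpow⟩
  have := hnil.isUnit_one_sub
  rw [isUnit_iff_isIso] at this
  rw [Functor.map_sub, CategoryTheory.Functor.map_id]
  exact this

/-- A compatible family of morphisms from a compact object to a sequence of objects whose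
cohomology vanishes locally is eventually zero. -/
lemma exists_eq_zero_of_isCompactObject {S : DerivedCategory (ModuleCat.{u} R)}
    (hS : IsCompactObject.{u} S) (hX : ∀ m : ℤ, ∃ N : ℕ, ∀ k ≥ N,
      IsZero ((homologyFunctor (ModuleCat.{u} R) m).obj (X k)))
    (g : ∀ k, S ⟶ X k) (hg : ∀ k, g (k + 1) = g k ≫ φ k) : ∃ k, g k = 0 := by
  obtain ⟨c, ⟨hc⟩⟩ : ∃ c : Cofan fun k : ULift.{u} ℕ => X k.down, Nonempty (IsColimit c) :=
    ⟨_, ⟨coproductIsCoproduct _⟩⟩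
  have : IsIso (𝟙 c.pt - telescopeShift φ hc) := by
    refine isIso_one_sub_telescopeShift φ hc fun m => ?_
    obtain ⟨N, hN⟩ := hX m
    refine ⟨N, fun k ψ _ => ?_⟩
    rw [Functor.map_comp, (hN (k + N) (by lia)).eq_of_tgt ((homologyFunctor _ m).map ψ) 0, zero_comp]
  -- The geometric series in the shift applied to `g 0`: its component at `k` is `g k`, and
  -- compactness leaves only finitely many nonzero components.
  let G : S ⟶ c.pt := g 0 ≫ c.inj ⟨0⟩ ≫ inv (𝟙 c.pt - telescopeShift φ hc)
  have hG : G = g 0 ≫ c.inj ⟨0⟩ + G ≫ telescopeShift φ hc := by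
    have : G ≫ (𝟙 c.pt - telescopeShift φ hc) = g 0 ≫ c.inj ⟨0⟩ := by
      simp only [G, Category.assoc, IsIso.inv_hom_id, Category.comp_id]
    rw [Preadditive.comp_sub, Category.comp_id] at this
    rw [← this, sub_add_cancel]
  have hzero : telescopeShift φ hc ≫ proj hc ⟨0⟩ = 0 := by
    refine Cofan.IsColimit.hom_ext hc _ _ fun ⟨k⟩ => ?_
    rw [inj_telescopeShift_assoc, inj_proj_of_ne hc (by simp), comp_zero, comp_zero]
  have hsucc (k : ℕ) : telescopeShift φ hc ≫ proj hc ⟨k + 1⟩ = proj hc ⟨k⟩ ≫ φ k := by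
    refine Cofan.IsColimit.hom_ext hc _ _ fun ⟨l⟩ => ?_
    rw [inj_telescopeShift_assoc]
    by_cases h : l = k
    · subst h
      rw [inj_proj_self, inj_proj_self_assoc, Category.comp_id]
    · rw [inj_proj_of_ne hc (by simpa using h), inj_proj_of_ne_assoc hc (by simpa using h),
        comp_zero]
  have hGk (k : ℕ) : G ≫ proj hc ⟨k⟩ = g k := by
    induction k with
    | zero =>
      rw [hG, Preadditive.add_comp, Category.assoc, Category.assoc, hzero, inj_proj_self,
        comp_zero, add_zero, Category.comp_id]
    | succ k ih =>
      rw [hG, Preadditive.add_comp, Category.assoc, Category.assoc, hsucc,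
        inj_proj_of_ne hc (by simp), comp_zero, zero_add, reassoc_of% ih, hg]
  obtain ⟨s, hs⟩ := hS.exists_comp_trunc_eq hc G
  obtain ⟨k, hk⟩ := Infinite.exists_notMem_finset s
  refine ⟨k.down, ?_⟩
  rw [← hGk, ← hs, Category.assoc, trunc_proj_of_notMem hc hk, comp_zero]

/-- A compatible family of morphisms out of a sequence of objects whose transition maps vanish in
cohomology is zero. -/
lemma eq_zero_of_compatible {W : DerivedCategory (ModuleCat.{u} R)}
    (hφ : ∀ k m, (homologyFunctor (ModuleCat.{u} R) m).map (φ k) = 0)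
    (f : ∀ k, X k ⟶ W) (hf : ∀ k, φ k ≫ f (k + 1) = f k) (k : ℕ) : f k = 0 := by
  obtain ⟨c, ⟨hc⟩⟩ : ∃ c : Cofan fun k : ULift.{u} ℕ => X k.down, Nonempty (IsColimit c) :=
    ⟨_, ⟨coproductIsCoproduct _⟩⟩
  have : IsIso (𝟙 c.pt - telescopeShift φ hc) := by
    refine isIso_one_sub_telescopeShift φ hc fun m => ⟨1, fun k ψ h => ?_⟩
    rw [← h, pow_one, inj_telescopeShift, Functor.map_comp, hφ, zero_comp]
  -- Compatibility of the family says exactly that `F` is killed by one minus the shift, which is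
  -- invertible.
  let F : c.pt ⟶ W := Cofan.IsColimit.desc hc fun k => f k.down
  have hF : (𝟙 c.pt - telescopeShift φ hc) ≫ F = 0 := by
    rw [Preadditive.sub_comp, Category.id_comp, sub_eq_zero]
    refine Cofan.IsColimit.hom_ext hc _ _ fun ⟨k⟩ => ?_
    rw [inj_telescopeShift_assoc, Cofan.IsColimit.fac, Cofan.IsColimit.fac, hf]
  rw [Preadditive.IsIso.comp_left_eq_zero] at hF
  rw [← Cofan.IsColimit.fac hc (fun k => f k.down) ⟨k⟩]
  exact (c.inj ⟨k⟩ ≫= hF).trans comp_zero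

end Telescope

end DerivedTelescope

/-! ### Ghost maps, and idempotent ideals killing groups of morphisms. -/

namespace DerivedTelescope

open Cofan DerivedCategory

variable {R : Type u} [CommRing R] [HasDerivedCategory.{w} (ModuleCat.{u} R)]

section Triangle

variable {T : Type*} [Category* T] [Preadditive T] [HasZeroObject T] [HasShift T ℤ]
  [∀ n : ℤ, (shiftFunctor T n).Additive] [Pretriangulated T]
  {X Y Z W : T} {f : X ⟶ Y} {g : Y ⟶ Z} {h : Z ⟶ X⟦(1 : ℤ)⟧}

lemma exists_desc_of_distTriang (hT : Triangle.mk f g h ∈ distTriang T) (p : Y ⟶ W)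
    (hp : f ≫ p = 0) : ∃ q : Z ⟶ W, g ≫ q = p := by
  obtain ⟨q, hq⟩ := Triangle.yoneda_exact₂ _ hT p hp
  exact ⟨q, hq.symm⟩

lemma exists_lift_of_distTriang (hT : Triangle.mk f g h ∈ distTriang T) (p : W ⟶ Y)
    (hp : p ≫ g = 0) : ∃ q : W ⟶ X, q ≫ f = p := by
  obtain ⟨q, hq⟩ := Triangle.coyoneda_exact₂ _ hT p hp
  exact ⟨q, hq.symm⟩

end Triangle

/-- The cohomology modules of `X` are annihilated by the ideal `I`. -/
def IsCohomologyKilledBy (I : Ideal R) (X : DerivedCategory (ModuleCat.{u} R)) : Prop :=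
  ∀ a ∈ I, ∀ (n : ℤ) (x : (homologyFunctor (ModuleCat.{u} R) n).obj X), a • x = 0

/-- The morphism from a shifted copy of `R` given by a cohomology class. -/
lemma exists_sgl_hom {X : DerivedCategory (ModuleCat.{u} R)} {n : ℤ}
    (x : (homologyFunctor (ModuleCat.{u} R) n).obj X) :
    ∃ f : sgl n (ModuleCat.of R R) ⟶ X,
      (homologyFunctor _ n).map f ((homologySglIso n (ModuleCat.of R R)).inv (1 : R)) = x := by
  obtain ⟨f, hf⟩ := (sgl_hom_bijective n (ModuleCat.of R R) X).surjective
    (ModuleCat.ofHom (LinearMap.toSpanSingleton R _ x))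
  refine ⟨f, (ConcreteCategory.congr_hom hf (1 : R)).trans ?_⟩
  exact LinearMap.toSpanSingleton_apply_one R _ x

lemma sgl_hom_ext {X : DerivedCategory (ModuleCat.{u} R)} {n : ℤ}
    {f g : sgl n (ModuleCat.of R R) ⟶ X}
    (h : (homologyFunctor _ n).map f ((homologySglIso n (ModuleCat.of R R)).inv (1 : R)) =
      (homologyFunctor _ n).map g ((homologySglIso n (ModuleCat.of R R)).inv (1 : R))) : f = g := by
  refine (sgl_hom_bijective n (ModuleCat.of R R) X).injective ?_
  ext
  exact h

lemma IsCohomologyKilledBy.smul_sgl_hom {I : Ideal R} {X : DerivedCategory (ModuleCat.{u} R)}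
    (hX : IsCohomologyKilledBy I X) {a : R} (ha : a ∈ I) {n : ℤ}
    (f : sgl n (ModuleCat.of R R) ⟶ X) : a • f = 0 := by
  refine sgl_hom_ext ?_
  rw [Functor.map_smul, Functor.map_zero]
  exact hX a ha n _

/-- Every object receives a morphism from a coproduct of shifts of `R` which is surjective in
cohomology; the next term of the sequence is its cone. -/
lemma exists_ghost (X : DerivedCategory (ModuleCat.{u} R)) :
    ∃ (X' : DerivedCategory (ModuleCat.{u} R)) (φ : X ⟶ X'),
      (∀ m, (homologyFunctor (ModuleCat.{u} R) m).map φ = 0) ∧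
      ∀ (W : DerivedCategory (ModuleCat.{u} R)) (f : X ⟶ W),
        (∀ n (g : sgl n (ModuleCat.of R R) ⟶ X), g ≫ f = 0) → ∃ f' : X' ⟶ W, φ ≫ f' = f := by
  -- One summand for each cohomology class makes the map to `X` surjective in cohomology, so the
  -- next map of the triangle is zero there.
  let J : Type u := Σ m : ℤ, (homologyFunctor (ModuleCat.{u} R) m).obj X
  choose g hg using fun j : J => exists_sgl_hom j.2
  obtain ⟨c, ⟨hc⟩⟩ : ∃ c : Cofan fun j : J => sgl j.1 (ModuleCat.of R R), Nonempty (IsColimit c) :=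
    ⟨_, ⟨coproductIsCoproduct _⟩⟩
  obtain ⟨X', φ, δ, hT⟩ := distinguished_cocone_triangle (Cofan.IsColimit.desc hc g)
  refine ⟨X', φ, fun m => ?_, fun W f hf => ?_⟩
  · have hepi : Epi ((homologyFunctor (ModuleCat.{u} R) m).map (Cofan.IsColimit.desc hc g)) := by
      rw [ModuleCat.epi_iff_surjective]
      intro x
      refine ⟨(homologyFunctor _ m).map (c.inj ⟨m, x⟩)
        ((homologySglIso m (ModuleCat.of R R)).inv (1 : R)), ?_⟩
      rw [← ModuleCat.comp_apply, ← Functor.map_comp, Cofan.IsColimit.fac]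
      exact hg ⟨m, x⟩
    exact (HomologySequence.epi_homologyMap_mor₁_iff _ hT m).1 hepi
  · refine exists_desc_of_distTriang hT f (Cofan.IsColimit.hom_ext hc _ _ fun j => ?_)
    rw [Cofan.IsColimit.fac_assoc, hf, comp_zero]

/-- If the cohomology of `W` is annihilated by an idempotent ideal, then so are all groups of
morphisms to `W`. -/
lemma IsCohomologyKilledBy.smul_hom {I : Ideal R} (hI : I * I = I)
    {W : DerivedCategory (ModuleCat.{u} R)} (hW : IsCohomologyKilledBy I W)
    {X : DerivedCategory (ModuleCat.{u} R)} {a : R} (ha : a ∈ I) (f : X ⟶ W) : a • f = 0 := by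
  choose next φ hφ hlift using fun X : DerivedCategory (ModuleCat.{u} R) => exists_ghost X
  have lift₁ (Y : DerivedCategory (ModuleCat.{u} R)) (f : Y ⟶ W)
      (hf : f ∈ I • (⊤ : Submodule R (Y ⟶ W))) : ∃ f' : next Y ⟶ W, φ Y ≫ f' = f := by
    induction hf using Submodule.smul_induction_on' with
    | smul a ha f _ =>
      refine hlift Y W _ fun n g => ?_
      rw [Linear.comp_smul]
      exact hW.smul_sgl_hom ha _
    | add f _ g _ hf hg =>
      obtain ⟨f', rfl⟩ := hf
      obtain ⟨g', rfl⟩ := hg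
      exact ⟨f' + g', Preadditive.comp_add _ _ _ _ _ _⟩
  -- Since `I = I * I`, one factor from `I` is spent on extending and the other stays on the
  -- extension, so the step can be iterated.
  have lift₂ (Y : DerivedCategory (ModuleCat.{u} R)) (f : Y ⟶ W)
      (hf : f ∈ I • (⊤ : Submodule R (Y ⟶ W))) :
      ∃ f' : next Y ⟶ W, f' ∈ I • (⊤ : Submodule R (next Y ⟶ W)) ∧ φ Y ≫ f' = f := by
    rw [← hI, Submodule.mul_smul] at hf
    induction hf using Submodule.smul_induction_on' with
    | smul a ha f hf =>
      obtain ⟨f', rfl⟩ := lift₁ Y f hf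
      exact ⟨a • f', Submodule.smul_mem_smul ha trivial, Linear.comp_smul _ _ _ _ _ _⟩
    | add f _ g _ hf hg =>
      obtain ⟨f', hf', rfl⟩ := hf
      obtain ⟨g', hg', rfl⟩ := hg
      exact ⟨f' + g', add_mem hf' hg', Preadditive.comp_add _ _ _ _ _ _⟩
  choose! lift hlift_mem hlift_comp using lift₂
  let St := Σ Y : DerivedCategory (ModuleCat.{u} R), {f : Y ⟶ W // f ∈ I • (⊤ : Submodule R (Y ⟶ W))}
  let step (s : St) : St := ⟨next s.1, lift s.1 s.2.1, hlift_mem s.1 s.2.1 s.2.2⟩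
  let seq (k : ℕ) : St :=
    Nat.rec ⟨X, a • f, Submodule.smul_mem_smul ha trivial⟩ (fun _ => step) k
  exact eq_zero_of_compatible (X := fun k => (seq k).1) (fun k => φ (seq k).1)
    (fun k m => hφ (seq k).1 m) (fun k => (seq k).2.1)
    (fun k => hlift_comp (seq k).1 (seq k).2.1 (seq k).2.2) 0

end DerivedTelescope

/-! ### Derived tensor products, studied through duals into injective modules. -/

namespace DerivedTelescope

open DerivedCategory

section Tensor

variable {R : Type u} [CommRing R] (P N : CochainComplex (ModuleCat.{u} R) ℤ)

/-- The bilinear map from the components of two complexes to their tensor product. -/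
noncomputable def tensorMk (p q n : ℤ) (h : p + q = n) :
    P.X p →ₗ[R] N.X q →ₗ[R] (HomologicalComplex.tensorObj P N).X n :=
  TensorProduct.curry (HomologicalComplex.ιTensorObj P N p q n h).hom

variable {P N}

lemma tensorObj_hom_ext {n : ℤ} {J : ModuleCat.{u} R}
    {f g : (HomologicalComplex.tensorObj P N).X n ⟶ J}
    (h : ∀ p q (hpq : p + q = n) x y, f (tensorMk P N p q n hpq x y) =
      g (tensorMk P N p q n hpq x y)) : f = g := by
  refine HomologicalComplex.mapBifunctor.hom_ext fun p q hpq => ?_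
  refine ModuleCat.MonoidalCategory.tensor_ext fun x y => ?_
  exact h p q hpq x y

lemma exists_tensorObj_desc {n : ℤ} {J : ModuleCat.{u} R}
    (b : ∀ p q, p + q = n → (P.X p →ₗ[R] N.X q →ₗ[R] J)) :
    ∃ f : (HomologicalComplex.tensorObj P N).X n ⟶ J, ∀ p q (hpq : p + q = n) x y,
      f (tensorMk P N p q n hpq x y) = b p q hpq x y := by
  let φ (p q : ℤ) (h : p + q = n) :
      ((MonoidalCategory.curriedTensor _).obj (P.X p)).obj (N.X q) ⟶ J :=
    ModuleCat.ofHom (TensorProduct.lift (b p q h))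
  refine ⟨HomologicalComplex.mapBifunctorDesc φ, fun p q hpq x y => ?_⟩
  have := HomologicalComplex.ι_mapBifunctorDesc (K₁ := P) (K₂ := N) (c := ComplexShape.up ℤ)
    (F := MonoidalCategory.curriedTensor (ModuleCat.{u} R)) φ p q hpq
  exact ConcreteCategory.congr_hom this (TensorProduct.tmul R x y)

lemma d_tensorMk (p q n : ℤ) (h : p + q = n) (x : P.X p) (y : N.X q) :
    (HomologicalComplex.tensorObj P N).d n (n + 1) (tensorMk P N p q n h x y) =
      tensorMk P N (p + 1) q (n + 1) (by lia) (P.d p (p + 1) x) y +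
        p.negOnePow • tensorMk P N p (q + 1) (n + 1) (by lia) x (N.d q (q + 1) y) := by
  have h1 := HomologicalComplex.mapBifunctor.d₁_eq P N
    (MonoidalCategory.curriedTensor (ModuleCat.{u} R)) (ComplexShape.up ℤ)
    (show (ComplexShape.up ℤ).Rel p (p + 1) by simp) q (n + 1) (show p + 1 + q = n + 1 by lia)
  have h2 := HomologicalComplex.mapBifunctor.d₂_eq P N
    (MonoidalCategory.curriedTensor (ModuleCat.{u} R)) (ComplexShape.up ℤ) p
    (show (ComplexShape.up ℤ).Rel q (q + 1) by simp) (n + 1) (show p + (q + 1) = n + 1 by lia)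
  have h3 : HomologicalComplex.ιTensorObj P N p q n h ≫
      (HomologicalComplex.tensorObj P N).d n (n + 1) =
      HomologicalComplex.mapBifunctor.d₁ P N
        (MonoidalCategory.curriedTensor (ModuleCat.{u} R)) (ComplexShape.up ℤ) p q (n + 1) +
      HomologicalComplex.mapBifunctor.d₂ P N
        (MonoidalCategory.curriedTensor (ModuleCat.{u} R)) (ComplexShape.up ℤ) p q (n + 1) := by
    rw [HomologicalComplex.mapBifunctor.d_eq, Preadditive.comp_add]
    exact congrArg₂ (· + ·) (HomologicalComplex.mapBifunctor.ι_D₁ ..)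
      (HomologicalComplex.mapBifunctor.ι_D₂ ..)
  rw [h1, h2] at h3
  have e1 : ComplexShape.ε₁ (ComplexShape.up ℤ) (ComplexShape.up ℤ) (ComplexShape.up ℤ) (p, q) = 1 :=
    rfl
  have e2 : ComplexShape.ε₂ (ComplexShape.up ℤ) (ComplexShape.up ℤ) (ComplexShape.up ℤ) (p, q) =
    p.negOnePow := rfl
  rw [e1, e2, one_smul] at h3
  exact ConcreteCategory.congr_hom h3 (TensorProduct.tmul R x y)

lemma d_tensorMk' {p p' q q' n m : ℤ} (hp : p + 1 = p') (hq : q + 1 = q') (hn : n + 1 = m)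
    (h : p + q = n) (x : P.X p) (y : N.X q) :
    (HomologicalComplex.tensorObj P N).d n m (tensorMk P N p q n h x y) =
      tensorMk P N p' q m (by lia) (P.d p p' x) y +
        p.negOnePow • tensorMk P N p q' m (by lia) x (N.d q q' y) := by
  subst hp hq hn
  exact d_tensorMk p q n h x y

end Tensor

section Dual

variable {R : Type u} [CommRing R]

/-- The complex `Hom(N, J[-n])` of homomorphisms to a module placed in degree `n`. -/
noncomputable def homToSingle (N : CochainComplex (ModuleCat.{u} R) ℤ) (J : ModuleCat.{u} R)
    (n : ℤ) : CochainComplex (ModuleCat.{u} R) ℤ where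
  X p := ModuleCat.of R (N.X (n - p) →ₗ[R] J)
  -- With this sign, the adjoint of a map `(P ⊗ N)^n ⟶ J` vanishing on boundaries is a chain map
  -- without further signs.
  d p q := q.negOnePow • ModuleCat.ofHom (LinearMap.lcomp R J (N.d (n - q) (n - p)).hom)
  shape p q hpq := by
    have : N.d (n - q) (n - p) = 0 := N.shape _ _ (by
      simp only [ComplexShape.up_Rel] at hpq ⊢
      lia)
    ext f x
    simp [this]
  d_comp_d' p q r _ _ := by
    ext f x
    have h : N.d (n - q) (n - p) (N.d (n - r) (n - q) x) = 0 :=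
      ConcreteCategory.congr_hom (N.d_comp_d (n - r) (n - q) (n - p)) x
    let f' : N.X (n - p) →ₗ[R] J := f
    change r.negOnePow • q.negOnePow • f' (N.d (n - q) (n - p) (N.d (n - r) (n - q) x)) = 0
    rw [h, map_zero, smul_zero (M := ℤˣ) (A := J), smul_zero (M := ℤˣ) (A := J)]

/-- Elements of the complex `Hom(N, J[-n])` as linear maps. -/
noncomputable def homToSingleEquiv (N : CochainComplex (ModuleCat.{u} R) ℤ) (J : ModuleCat.{u} R)
    (n p : ℤ) : (homToSingle N J n).X p ≃ₗ[R] (N.X (n - p) →ₗ[R] J) :=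
  LinearEquiv.refl R _

lemma homToSingle_d_apply (N : CochainComplex (ModuleCat.{u} R) ℤ) (J : ModuleCat.{u} R)
    (n p q : ℤ) (f : (homToSingle N J n).X p) (x : N.X (n - q)) :
    homToSingleEquiv N J n q ((homToSingle N J n).d p q f) x =
      q.negOnePow • homToSingleEquiv N J n p f (N.d (n - q) (n - p) x) := by
  rfl

lemma exists_comp_eq_of_injective {A B J : ModuleCat.{u} R} [Injective J] (D : A ⟶ B) (g : A ⟶ J)
    (h : ∀ x, D x = 0 → g x = 0) : ∃ l : B ⟶ J, D ≫ l = g := by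
  have hex : (ShortComplex.mk (kernel.ι D) D (kernel.condition D)).Exact :=
    ShortComplex.exact_of_f_is_kernel _ (kernelIsKernel D)
  refine ⟨hex.descToInjective g ?_, hex.comp_descToInjective g _⟩
  ext x
  exact h _ (ConcreteCategory.congr_hom (kernel.condition D) x)

/-- The bilinear map corresponding to a map to the complex `Hom(N, J[-n])`. -/
noncomputable def uncurryHomToSingle {P N : CochainComplex (ModuleCat.{u} R) ℤ} {J : ModuleCat.{u} R} {n p r q : ℤ} (hq : n - r = q)
    (h : P.X p ⟶ (homToSingle N J n).X r) : P.X p →ₗ[R] N.X q →ₗ[R] J :=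
  LinearMap.lcomp R J (N.XIsoOfEq hq.symm).hom.hom ∘ₗ (homToSingleEquiv N J n r).toLinearMap ∘ₗ h.hom

/-- Index transport: a homotopy component is met in degree `p + 1 - 1` where degree `p` is wanted.
-/
lemma uncurryHomToSingle_family_apply {P N : CochainComplex (ModuleCat.{u} R) ℤ}
    {J : ModuleCat.{u} R} {n p r r' : ℤ} (h : ∀ p r, P.X p ⟶ (homToSingle N J n).X r)
    (hr : r = r') (hq : n - r = n - r') (x : P.X p) (y : N.X (n - r')) :
    uncurryHomToSingle hq (h p r) x y = homToSingleEquiv N J n r' (h p r' x) y := by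
  subst hr
  rfl

end Dual

section Homology

variable {R : Type u} [CommRing R] (K : CochainComplex (ModuleCat.{u} R) ℤ)

lemma exists_iCycles_eq {n : ℤ} (y : K.X n) (hy : K.d n (n + 1) y = 0) :
    ∃ z : K.cycles n, K.iCycles n z = y := by
  have h : ModuleCat.ofHom (LinearMap.toSpanSingleton R _ y) ≫ K.d n (n + 1) = 0 := by
    ext
    simpa using hy
  refine ⟨K.liftCycles _ (n + 1) (by simp) h (1 : R), ?_⟩
  rw [← ModuleCat.comp_apply, HomologicalComplex.liftCycles_i]
  exact LinearMap.toSpanSingleton_apply_one R _ y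

lemma homologyπ_eq_zero_iff {n : ℤ} (z : K.cycles n) :
    K.homologyπ n z = 0 ↔ ∃ x : K.X (n - 1), K.d (n - 1) n x = K.iCycles n z := by
  have hex : (ShortComplex.mk _ _ (K.toCycles_comp_homologyπ (n - 1) n)).Exact :=
    ShortComplex.exact_of_g_is_cokernel _ (K.homologyIsCokernel (n - 1) n (by simp))
  rw [ShortComplex.moduleCat_exact_iff] at hex
  constructor
  · intro h
    obtain ⟨x, hx⟩ := hex z h
    refine ⟨x, ?_⟩
    rw [← hx]
    exact (ConcreteCategory.congr_hom (K.toCycles_i (n - 1) n) x).symm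
  · rintro ⟨x, hx⟩
    have : z = K.toCycles (n - 1) n x := by
      apply (ModuleCat.mono_iff_injective (K.iCycles n)).1 inferInstance
      rw [← hx]
      exact (ConcreteCategory.congr_hom (K.toCycles_i (n - 1) n) x).symm
    rw [this]
    exact ConcreteCategory.congr_hom (K.toCycles_comp_homologyπ (n - 1) n) x

lemma smul_homology_eq_zero_iff (n : ℤ) (a : R) :
    (∀ x : K.homology n, a • x = 0) ↔
      ∀ y : K.X n, K.d n (n + 1) y = 0 → ∃ x : K.X (n - 1), K.d (n - 1) n x = a • y := by
  constructor
  · intro h y hy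
    obtain ⟨z, rfl⟩ := exists_iCycles_eq K y hy
    rw [← map_smul, ← homologyπ_eq_zero_iff, map_smul, h]
  · intro h x
    obtain ⟨z, rfl⟩ := (ModuleCat.epi_iff_surjective (K.homologyπ n)).1 inferInstance x
    rw [← map_smul, homologyπ_eq_zero_iff, map_smul]
    refine h _ ?_
    exact ConcreteCategory.congr_hom (K.iCycles_d n (n + 1)) z

variable [HasDerivedCategory.{w} (ModuleCat.{u} R)]

lemma isCohomologyKilledBy_Q_obj_iff (I : Ideal R) :
    IsCohomologyKilledBy I (Q.obj K) ↔ ∀ a ∈ I, ∀ (n : ℤ) (y : K.X n), K.d n (n + 1) y = 0 →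
      ∃ x : K.X (n - 1), K.d (n - 1) n x = a • y := by
  refine forall₂_congr fun a _ => forall_congr' fun n => ?_
  rw [← smul_homology_eq_zero_iff]
  let e := (homologyQIso K n).toLinearEquiv
  constructor
  · intro h x
    rw [← e.apply_symm_apply x, ← map_smul, h, map_zero]
  · intro h x
    rw [← e.symm_apply_apply x, ← map_smul, h, map_zero]

end Homology

section TensorKilled

variable {R : Type u} [CommRing R] [HasDerivedCategory.{w} (ModuleCat.{u} R)] {I : Ideal R}
  {P N : CochainComplex (ModuleCat.{u} R) ℤ}

lemma IsCohomologyKilledBy.exists_d_eq_smul (hN : IsCohomologyKilledBy I (Q.obj N)) {a : R}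
    (ha : a ∈ I) {i j k : ℤ} (hi : i + 1 = j) (hk : j + 1 = k) (y : N.X j) (hy : N.d j k y = 0) :
    ∃ x : N.X i, N.d i j x = a • y := by
  obtain rfl : i = j - 1 := by lia
  subst hk
  exact (isCohomologyKilledBy_Q_obj_iff N I).1 hN a ha j y hy

/-- A cocycle `g` vanishes on boundaries, and `a` sends cycles of `N` to boundaries, so `a • g`
vanishes on cycles. It therefore factors through the differential, by injectivity of `J`. -/
lemma IsCohomologyKilledBy.homToSingle_of_injective (hN : IsCohomologyKilledBy I (Q.obj N))
    (J : ModuleCat.{u} R) [Injective J] (n : ℤ) :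
    IsCohomologyKilledBy I (Q.obj (homToSingle N J n)) := by
  rw [isCohomologyKilledBy_Q_obj_iff]
  intro a ha p y hy
  set g := homToSingleEquiv N J n p y with hg
  have hgd (x : N.X (n - (p + 1))) : g (N.d (n - (p + 1)) (n - p) x) = 0 := by
    have := homToSingle_d_apply N J n p (p + 1) y x
    rw [hy, map_zero, LinearMap.zero_apply] at this
    rw [hg]
    exact (smul_eq_zero_iff_eq _).1 this.symm
  obtain ⟨l, hl⟩ := exists_comp_eq_of_injective (N.d (n - p) (n - (p - 1)))
    (ModuleCat.ofHom (a • g)) (fun x hx => by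
      obtain ⟨z, hz⟩ := hN.exists_d_eq_smul ha (i := n - (p + 1)) (by lia) (by lia) x hx
      change a • g x = 0
      rw [← map_smul, ← hz, hgd])
  refine ⟨(homToSingleEquiv N J n (p - 1)).symm (p.negOnePow • l.hom), ?_⟩
  apply (homToSingleEquiv N J n p).injective
  refine LinearMap.ext fun x => ?_
  rw [homToSingle_d_apply, LinearEquiv.apply_symm_apply, map_smul, ← hg]
  change p.negOnePow • p.negOnePow • (l.hom _) = _
  rw [smul_smul, Int.units_mul_self, one_smul]
  exact ConcreteCategory.congr_hom hl x

/-- By adjunction `θ` is a chain map `η` from `P` to Hom(N, J[-n]), whose cohomology is killed by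
`I`. So `a • η` vanishes in the derived category by `smul_hom`, and is null-homotopic as `P` is
K-projective; the homotopy is adjoint to `κ`. -/
lemma exists_smul_eq_d_comp (hI : I * I = I) [P.IsKProjective]
    (hN : IsCohomologyKilledBy I (Q.obj N)) {J : ModuleCat.{u} R} [Injective J] {n : ℤ}
    (θ : (HomologicalComplex.tensorObj P N).X n ⟶ J)
    (hθ : (HomologicalComplex.tensorObj P N).d (n - 1) n ≫ θ = 0) {a : R} (ha : a ∈ I) :
    ∃ κ : (HomologicalComplex.tensorObj P N).X (n + 1) ⟶ J,
      (HomologicalComplex.tensorObj P N).d n (n + 1) ≫ κ = a • θ := by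
  have hθ' {p p' q q' : ℤ} (hp : p + 1 = p') (hq : q + 1 = q') (h : p + q + 1 = n) (x : P.X p)
      (y : N.X q) : θ (tensorMk P N p' q n (by lia) (P.d p p' x) y) =
        p'.negOnePow • θ (tensorMk P N p q' n (by lia) x (N.d q q' y)) := by
    have h1 := ConcreteCategory.congr_hom hθ (tensorMk P N p q (n - 1) (by lia) x y)
    rw [ModuleCat.comp_apply, d_tensorMk' hp hq (by lia), map_add, Units.smul_def, map_zsmul, ← Units.smul_def] at h1
    rw [show p'.negOnePow = (p + 1).negOnePow by rw [hp], Int.negOnePow_succ, Units.neg_smul]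
    exact eq_neg_of_add_eq_zero_left h1
  let η : P ⟶ homToSingle N J n :=
    { f p := ModuleCat.ofHom ((homToSingleEquiv N J n p).symm.toLinearMap ∘ₗ
        (tensorMk P N p (n - p) n (by lia)).compr₂ θ.hom)
      comm' p p' hp := by
        ext x
        apply (homToSingleEquiv N J n p').injective
        refine LinearMap.ext fun y => ?_
        refine (homToSingle_d_apply N J n p p' _ y).trans ?_
        exact (hθ' hp (by simp at hp; lia) (by simp at hp; lia) x y).symm }
  have hη (p : ℤ) (x : P.X p) (y : N.X (n - p)) : homToSingleEquiv N J n p (η.f p x) y =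
      θ (tensorMk P N p (n - p) n (by lia) x y) := rfl
  have hz : Q.map (a • η) = 0 := by
    rw [Functor.map_smul]
    exact (hN.homToSingle_of_injective J n).smul_hom hI ha (Q.map η)
  obtain ⟨h⟩ := homotopy_zero_of_Q_map_eq_zero (a • η) hz
  obtain ⟨κ, hκ⟩ := exists_tensorObj_desc (P := P) (N := N) (n := n + 1) (J := J)
    fun p q hpq => uncurryHomToSingle (r := p - 1) (by lia) (h.hom p (p - 1))
  refine ⟨κ, tensorObj_hom_ext fun p q hpq x y => ?_⟩
  obtain rfl : q = n - p := eq_sub_of_add_eq' hpq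
  have hc := ConcreteCategory.congr_hom (h.comm p) x
  rw [dNext_eq _ (show (ComplexShape.up ℤ).Rel p (p + 1) by simp),
    prevD_eq _ (show (ComplexShape.up ℤ).Rel (p - 1) p by simp)] at hc
  have hc' := congrArg (fun z => homToSingleEquiv N J n p z y) hc
  have hq : n - p + 1 = n - (p - 1) := by ring
  have e1 : κ (tensorMk P N (p + 1) (n - p) (n + 1) (by ring) (P.d p (p + 1) x) y) =
      homToSingleEquiv N J n p (h.hom (p + 1) p (P.d p (p + 1) x)) y :=
    (hκ _ _ _ _ _).trans (uncurryHomToSingle_family_apply h.hom (add_sub_cancel_right p 1) _ _ y)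
  have e2 : κ (tensorMk P N p (n - (p - 1)) (n + 1) (by ring) x (N.d (n - p) (n - (p - 1)) y)) =
      homToSingleEquiv N J n (p - 1) (h.hom p (p - 1) x) (N.d (n - p) (n - (p - 1)) y) :=
    hκ _ _ _ _ _
  have e3 := homToSingle_d_apply N J n (p - 1) p (h.hom p (p - 1) x) y
  rw [ModuleCat.comp_apply, d_tensorMk' rfl hq rfl, map_add, Units.smul_def, map_zsmul,
    ← Units.smul_def, e1, e2, ← e3]
  exact ((hc'.trans (by simp)).symm)

/-- Embedding the cokernel of the incoming differential in an injective module gives a single `θ`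
that detects boundaries. Since `a • θ` factors through the outgoing differential, it vanishes on
cycles. -/
lemma IsCohomologyKilledBy.tensorObj (hI : I * I = I) [P.IsKProjective]
    (hN : IsCohomologyKilledBy I (Q.obj N)) :
    IsCohomologyKilledBy I (Q.obj (HomologicalComplex.tensorObj P N)) := by
  rw [isCohomologyKilledBy_Q_obj_iff]
  intro a ha n y hy
  let d := (HomologicalComplex.tensorObj P N).d (n - 1) n
  obtain ⟨κ, hκ⟩ := exists_smul_eq_d_comp hI hN (cokernel.π d ≫ Injective.ι (cokernel d))
    (by rw [cokernel.condition_assoc, zero_comp]) ha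
  have h1 : Injective.ι (cokernel d) (cokernel.π d (a • y)) = 0 := by
    have := ConcreteCategory.congr_hom hκ y
    rw [ModuleCat.comp_apply, hy, map_zero] at this
    rw [map_smul, map_smul]
    exact this.symm
  have h2 : cokernel.π d (a • y) = 0 :=
    (ModuleCat.mono_iff_injective (Injective.ι (cokernel d))).1 inferInstance
      (h1.trans (map_zero _).symm)
  have hex : (ShortComplex.mk d (cokernel.π d) (cokernel.condition d)).Exact :=
    ShortComplex.exact_of_g_is_cokernel _ (cokernelIsCokernel d)
  exact (ShortComplex.moduleCat_exact_iff _).1 hex _ h2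

end TensorKilled

end DerivedTelescope

/-! ### Objects with cohomology killed by an ideal form a definable ⊗-ideal. -/

namespace DerivedTelescope

open DerivedCategory

section Quotient

variable {R : Type u} [CommRing R]

lemma mem_essImage_restrictScalars_quotient_iff (I : Ideal R) (M : ModuleCat.{u} R) :
    (ModuleCat.restrictScalars.{u} (algebraMap R (R ⧸ I))).essImage M ↔
      ∀ a ∈ I, ∀ x : M, a • x = 0 := by
  constructor
  · rintro ⟨N, ⟨e⟩⟩ a ha x
    obtain ⟨y, rfl⟩ := e.toLinearEquiv.surjective x
    have h : a • y = 0 := by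
      change algebraMap R (R ⧸ I) a • (show N from y) = 0
      rw [Ideal.Quotient.algebraMap_eq, Ideal.Quotient.eq_zero_iff_mem.2 ha, zero_smul]
    rw [← map_smul, h, map_zero]
  · intro h
    have hM : Module.IsTorsionBySet R M I := fun x a => h a a.2 x
    let _ : Module (R ⧸ I) M := hM.module
    refine ⟨ModuleCat.of (R ⧸ I) M, ⟨LinearEquiv.toModuleIso ?_⟩⟩
    exact { AddEquiv.refl M with map_smul' := fun a x => rfl }

end Quotient

variable {R : Type u} [CommRing R] [HasDerivedCategory.{w} (ModuleCat.{u} R)] (I : Ideal R)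

lemma forall_smul_totalCohomology_eq_zero_iff (X : DerivedCategory (ModuleCat.{u} R)) :
    (∀ a ∈ I, ∀ x : totalCohomology X, a • x = 0) ↔ IsCohomologyKilledBy I X := by
  constructor
  · intro h a ha n x
    have := h a ha (DirectSum.lof R ℤ
      (fun n => ((homologyFunctor (ModuleCat.{u} R) n).obj X : ModuleCat.{u} R)) n x)
    apply DirectSum.of_injective (β := fun n : ℤ =>
      ((homologyFunctor (ModuleCat.{u} R) n).obj X : ModuleCat.{u} R)) n
    rw [map_zero]
    exact ((DirectSum.lof R ℤ (fun n => ((homologyFunctor (ModuleCat.{u} R) n).obj X :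
      ModuleCat.{u} R)) n).map_smul a x).trans this
  · intro h a ha x
    refine DFinsupp.ext fun n => ?_
    exact h a ha n _

lemma cohomologyFrom_quotient_iff (X : DerivedCategory (ModuleCat.{u} R)) :
    cohomologyFrom R (R ⧸ I) X ↔ IsCohomologyKilledBy I X := by
  rw [← forall_smul_totalCohomology_eq_zero_iff]
  exact mem_essImage_restrictScalars_quotient_iff I _

variable {I}

lemma IsCohomologyKilledBy.of_retract {X Y : DerivedCategory (ModuleCat.{u} R)} (e : Retract X Y)
    (hY : IsCohomologyKilledBy I Y) : IsCohomologyKilledBy I X := by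
  intro a ha n x
  have h : (homologyFunctor (ModuleCat.{u} R) n).map e.r
      ((homologyFunctor (ModuleCat.{u} R) n).map e.i x) = x := by
    rw [← ModuleCat.comp_apply, ← Functor.map_comp, e.retract, CategoryTheory.Functor.map_id]
    rfl
  rw [← h, ← map_smul, hY a ha, map_zero]

lemma IsCohomologyKilledBy.of_iso {X Y : DerivedCategory (ModuleCat.{u} R)} (e : X ≅ Y)
    (hY : IsCohomologyKilledBy I X) : IsCohomologyKilledBy I Y :=
  hY.of_retract (Retract.ofIso e.symm)

lemma IsCohomologyKilledBy.of_isZero {X : DerivedCategory (ModuleCat.{u} R)} (hX : IsZero X) :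
    IsCohomologyKilledBy I X := fun _ _ n _ =>
  (ModuleCat.subsingleton_of_isZero ((homologyFunctor (ModuleCat.{u} R) n).map_isZero hX)).elim _ _

lemma IsCohomologyKilledBy.shift {X : DerivedCategory (ModuleCat.{u} R)}
    (hX : IsCohomologyKilledBy I X) (i : ℤ) : IsCohomologyKilledBy I (X⟦i⟧) := by
  intro a ha n x
  let e : (homologyFunctor (ModuleCat.{u} R) n).obj (X⟦i⟧) ≅
      (homologyFunctor (ModuleCat.{u} R) (i + n)).obj X :=
    ((homologyFunctor (ModuleCat.{u} R) 0).shiftIso i n (i + n) rfl).app X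
  apply e.toLinearEquiv.injective
  rw [map_zero, map_smul]
  exact hX a ha _ _

/-- For `a`, `b` in `I`, multiplication by `b` pushes a class into the image of the first term,
where `a` kills it; such products generate `I`. -/
lemma IsCohomologyKilledBy.ext₂ (hI : I * I = I)
    {T : Triangle (DerivedCategory (ModuleCat.{u} R))} (hT : T ∈ distTriang _)
    (h₁ : IsCohomologyKilledBy I T.obj₁) (h₃ : IsCohomologyKilledBy I T.obj₃) :
    IsCohomologyKilledBy I T.obj₂ := by
  intro a ha n x
  rw [← hI] at ha
  induction ha using Submodule.mul_induction_on' with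
  | mem_mul_mem a ha b hb =>
    have hex := HomologySequence.exact₂ T hT n
    obtain ⟨y, hy⟩ := (ShortComplex.moduleCat_exact_iff _).1 hex (b • x)
      (by
        refine (map_smul _ _ _).trans ?_
        exact h₃ b hb n _)
    rw [mul_smul, ← hy]
    refine (map_smul _ _ _).symm.trans ?_
    rw [h₁ a ha n y]
    exact map_zero _
  | add a _ b _ h h' => rw [add_smul, h, h', add_zero]

lemma isThick_isCohomologyKilledBy (hI : I * I = I) :
    IsThick (IsCohomologyKilledBy (R := R) I) where
  isTriangulated :=
    haveI : ObjectProperty.IsClosedUnderIsomorphisms (IsCohomologyKilledBy (R := R) I) :=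
      ⟨fun e h => h.of_iso e⟩
    { exists_zero := ⟨_, isZero_zero _, IsCohomologyKilledBy.of_isZero (isZero_zero _)⟩
      isStableUnderShiftBy := fun i => ⟨fun _ hX => hX.shift i⟩
      toIsTriangulatedClosed₂ := .mk' fun _ hT h₁ h₃ => .ext₂ hI hT h₁ h₃ }
  isStableUnderRetracts := ⟨fun e h => h.of_retract e⟩

lemma IsCohomologyKilledBy.of_isDerivedTensor (hI : I * I = I)
    {X Y Z : DerivedCategory (ModuleCat.{u} R)} (h : IsDerivedTensor X Y Z)
    (hY : IsCohomologyKilledBy I Y) : IsCohomologyKilledBy I Z := by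
  obtain ⟨P, N, hP, -, ⟨e⟩, ⟨e'⟩⟩ := h
  exact ((hY.of_iso e.symm).tensorObj hI).of_iso e'

/-- The multiplications by elements of an ideal on the shifts of `R`. -/
inductive idealMultiplication (I : Ideal R) : MorphismProperty (DerivedCategory (ModuleCat.{u} R))
  | mk (a : R) (ha : a ∈ I) (n : ℤ) :
    idealMultiplication I (a • 𝟙 (sgl n (ModuleCat.of R R)))

lemma isDefinable_isCohomologyKilledBy : IsDefinable.{u} (IsCohomologyKilledBy (R := R) I) := by
  refine ⟨idealMultiplication I, ?_, fun X => ⟨?_, ?_⟩⟩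
  · rintro _ _ _ ⟨a, ha, n⟩
    exact ⟨isCompactObject_sgl R n, isCompactObject_sgl R n⟩
  · rintro hX _ _ _ ⟨a, ha, n⟩ g
    rw [Linear.smul_comp, Category.id_comp]
    exact hX.smul_sgl_hom ha g
  · intro h a ha n x
    obtain ⟨f, rfl⟩ := exists_sgl_hom x
    have hf := h _ (.mk a ha n) f
    rw [Linear.smul_comp, Category.id_comp] at hf
    have := congrArg (fun f => (homologyFunctor (ModuleCat.{u} R) n).map f
      ((homologySglIso n (ModuleCat.of R R)).inv (1 : R))) hf
    simp only [Functor.map_smul, Functor.map_zero] at this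
    exact this

lemma IsCohomologyKilledBy.sgl {M : ModuleCat.{u} R} (hM : ∀ a ∈ I, ∀ x : M, a • x = 0) (n : ℤ) :
    IsCohomologyKilledBy I (DerivedCategory.sgl n M) := by
  rw [isCohomologyKilledBy_Q_obj_iff]
  intro a ha m y _
  refine ⟨0, ?_⟩
  rw [map_zero]
  by_cases h : m = n
  · subst h
    apply (HomologicalComplex.singleObjXSelf (ComplexShape.up ℤ) m M).toLinearEquiv.injective
    rw [map_smul, hM a ha, map_zero]
  · exact (ModuleCat.subsingleton_of_isZero
      (HomologicalComplex.isZero_single_obj_X (ComplexShape.up ℤ) n M m h)).elim _ _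

lemma cohomologyFrom_quotient_eq (I : Ideal R) :
    cohomologyFrom R (R ⧸ I) = IsCohomologyKilledBy I := by
  ext X
  exact cohomologyFrom_quotient_iff I X

/-- The objects whose cohomology is annihilated by an idempotent ideal form a definable
`⊗`-ideal. -/
lemma isDefinableTensorIdeal_cohomologyFrom (hI : I * I = I) :
    IsDefinableTensorIdeal (cohomologyFrom R (R ⧸ I)) := by
  rw [cohomologyFrom_quotient_eq]
  exact {
    isThick := isThick_isCohomologyKilledBy hI
    tensor_mem := fun _ _ _ h hY => hY.of_isDerivedTensor hI h
    isDefinable := isDefinable_isCohomologyKilledBy }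

lemma isClosedUnderCohomology_cohomologyFrom (I : Ideal R) :
    IsClosedUnderCohomology (cohomologyFrom R (R ⧸ I)) := by
  rw [cohomologyFrom_quotient_eq]
  intro X hX
  exact IsCohomologyKilledBy.sgl ((forall_smul_totalCohomology_eq_zero_iff I X).2 hX) 0

end DerivedTelescope

/-! ### Compact objects are bounded above with finitely generated top cohomology. -/

namespace CategoryTheory.Limits.Cofan

variable {T : Type*} [Category* T] [Preadditive T] {J : Type*} {X : J → T} {c : Cofan X}

lemma inj_trunc_of_notMem (hc : IsColimit c) {s : Finset J} {j : J} (hj : j ∉ s) :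
    c.inj j ≫ trunc hc s = 0 := by
  rw [trunc, Preadditive.comp_sum]
  refine Finset.sum_eq_zero fun i hi => ?_
  rw [inj_proj_of_ne_assoc hc (by rintro rfl; exact hj hi)]

lemma exists_retract_trunc (hc : IsColimit c) (s : Finset J) {b : Cofan fun j : s => X j}
    (hb : IsColimit b) :
    ∃ (ι : b.pt ⟶ c.pt) (ρ : c.pt ⟶ b.pt), ι ≫ ρ = 𝟙 _ ∧ ρ ≫ ι = trunc hc s := by
  classical
  refine ⟨Cofan.IsColimit.desc hb fun j => c.inj j,
    Cofan.IsColimit.desc hc fun j => if h : j ∈ s then b.inj ⟨j, h⟩ else 0, ?_, ?_⟩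
  · refine Cofan.IsColimit.hom_ext hb _ _ fun j => ?_
    rw [Cofan.IsColimit.fac_assoc, Cofan.IsColimit.fac, dif_pos j.2]
    exact (Category.comp_id _).symm
  · refine Cofan.IsColimit.hom_ext hc _ _ fun j => ?_
    rw [Cofan.IsColimit.fac_assoc]
    by_cases h : j ∈ s
    · rw [dif_pos h, Cofan.IsColimit.fac, inj_trunc hc h]
    · rw [dif_neg h, zero_comp, inj_trunc_of_notMem hc h]

end CategoryTheory.Limits.Cofan

namespace DerivedTelescope

open Cofan DerivedCategory

section Compact

variable {T : Type*} [Category.{w} T] [Preadditive T]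

lemma isCompactObject_of_isZero {X : T} (hX : IsZero X) : IsCompactObject.{u} X :=
  isCompactObject_of_exists_comp_trunc_eq fun _ _ _ _ _ => ⟨∅, hX.eq_of_src _ _⟩

lemma isCompactObject_of_finite {J : Type*} [Finite J] {A : J → T} {b : Cofan A}
    (hb : IsColimit b) (hA : ∀ j, IsCompactObject.{u} (A j)) : IsCompactObject.{u} b.pt := by
  classical
  have := Fintype.ofFinite J
  refine isCompactObject_of_exists_comp_trunc_eq fun K B c hc p => ?_
  choose s hs using fun j => (hA j).exists_comp_trunc_eq hc (b.inj j ≫ p)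
  refine ⟨Finset.univ.biUnion s, Cofan.IsColimit.hom_ext hb _ _ fun j => ?_⟩
  rw [← Category.assoc, ← hs j, Category.assoc,
    trunc_trunc hc (Finset.subset_biUnion_of_mem s (Finset.mem_univ j))]

lemma exists_comp_map_shift_trunc_eq {S : T} (hS : IsCompactObject.{u} S) {J : Type u} {A : J → T}
    {c : Cofan A} (hc : IsColimit c) [HasShift T ℤ]
    [∀ n : ℤ, (shiftFunctor T n).Additive] (n : ℤ) (f : S ⟶ c.pt⟦n⟧) :
    ∃ s, f ≫ (trunc hc s)⟦n⟧' = f := by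
  obtain ⟨d, hd, e⟩ : ∃ d : Cofan fun j => (A j)⟦n⟧, ∃ hd : IsColimit d,
      ∃ e : d.pt ≅ c.pt⟦n⟧, ∀ j, d.inj j ≫ e.hom = (c.inj j)⟦n⟧' := by
    have hd := isColimitCofanMkObjOfIsColimit (shiftFunctor T n) A (fun j => c.inj j)
      (hc.ofIsoColimit (Cofan.ext (Iso.refl _) (fun j => Category.comp_id _)))
    exact ⟨_, hd, Iso.refl _, fun j => Category.comp_id _⟩
  obtain ⟨e, he⟩ := e
  obtain ⟨s, hs⟩ := hS.exists_comp_trunc_eq hd (f ≫ e.inv)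
  refine ⟨s, ?_⟩
  have key : e.hom ≫ (trunc hc s)⟦n⟧' = trunc hd s ≫ e.hom := by
    refine Cofan.IsColimit.hom_ext hd _ _ fun j => ?_
    rw [reassoc_of% (he j), ← Functor.map_comp]
    by_cases h : j ∈ s
    · rw [inj_trunc hc h, reassoc_of% (inj_trunc hd h), he]
    · rw [inj_trunc_of_notMem hc h, ← Category.assoc, inj_trunc_of_notMem hd h, zero_comp,
        Functor.map_zero]
  have hf : (f ≫ e.inv) ≫ e.hom = f := by
    rw [Category.assoc, e.inv_hom_id, Category.comp_id]
  conv_lhs => rw [← hf, Category.assoc, key, ← Category.assoc, hs, hf]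

end Compact

section Triangle

variable {T : Type*} [Category.{w} T] [Preadditive T] [HasZeroObject T] [HasShift T ℤ]
  [∀ n : ℤ, (shiftFunctor T n).Additive] [Pretriangulated T]
  {X Y Z W : T} {f : X ⟶ Y} {g : Y ⟶ Z} {h : Z ⟶ X⟦(1 : ℤ)⟧}

lemma exists_lift₃_of_distTriang (hT : Triangle.mk f g h ∈ distTriang T) (p : W ⟶ Z)
    (hp : p ≫ h = 0) : ∃ q : W ⟶ Y, q ≫ g = p := by
  obtain ⟨q, hq⟩ := Triangle.coyoneda_exact₃ _ hT p hp
  exact ⟨q, hq.symm⟩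

lemma exists_map₂_of_distTriang (hT : Triangle.mk f g h ∈ distTriang T)
    {X' Y' Z' : T} {f' : X' ⟶ Y'} {g' : Y' ⟶ Z'} {h' : Z' ⟶ X'⟦(1 : ℤ)⟧}
    (hT' : Triangle.mk f' g' h' ∈ distTriang T) (a : X ⟶ X') (c : Z ⟶ Z')
    (comm : h ≫ a⟦(1 : ℤ)⟧' = c ≫ h') : ∃ b : Y ⟶ Y', f ≫ b = a ≫ f' ∧ g ≫ c = b ≫ g' :=
  complete_distinguished_triangle_morphism₂ _ _ hT hT' a c comm

lemma comp_eq_zero₁₂_of_distTriang (hT : Triangle.mk f g h ∈ distTriang T) : f ≫ g = 0 :=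
  comp_distTriang_mor_zero₁₂ _ hT

lemma comp_eq_zero₂₃_of_distTriang (hT : Triangle.mk f g h ∈ distTriang T) : g ≫ h = 0 :=
  comp_distTriang_mor_zero₂₃ _ hT

/-- A truncation that is exact on `X` leaves an error that factors through `Z`, where a second
finite truncation captures it. -/
lemma IsCompactObject.ext₂ (hT : Triangle.mk f g h ∈ distTriang T) (hX : IsCompactObject.{u} X)
    (hZ : IsCompactObject.{u} Z) : IsCompactObject.{u} Y := by
  classical
  refine isCompactObject_of_exists_comp_trunc_eq fun J A c hc p => ?_
  obtain ⟨s, hs⟩ := hX.exists_comp_trunc_eq hc (f ≫ p)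
  obtain ⟨q, hq⟩ := exists_desc_of_distTriang hT (p - p ≫ trunc hc s) (by
    rw [Preadditive.comp_sub, ← Category.assoc, hs, sub_self])
  obtain ⟨t, ht⟩ := hZ.exists_comp_trunc_eq hc q
  refine ⟨s ∪ t, ?_⟩
  have hp : p = p ≫ trunc hc s + g ≫ q ≫ trunc hc t := by
    rw [ht, hq, add_sub_cancel]
  rw [hp]
  simp only [Preadditive.add_comp, Category.assoc, trunc_trunc hc Finset.subset_union_left,
    trunc_trunc hc Finset.subset_union_right]

end Triangle

variable {R : Type u} [CommRing R] [HasDerivedCategory.{w} (ModuleCat.{u} R)]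

/-- Compact objects with cohomology in degrees `≤ n`, finitely generated in degree `n`. -/
structure IsTopFinite (n : ℤ) (X : DerivedCategory (ModuleCat.{u} R)) : Prop where
  isCompactObject : IsCompactObject.{u} X
  isLE : X.IsLE n
  finite : Module.Finite R ((homologyFunctor (ModuleCat.{u} R) n).obj X)

lemma isTopFinite_of_isLE {X : DerivedCategory (ModuleCat.{u} R)} (hX : IsCompactObject.{u} X)
    {m n : ℤ} (h : m < n) (hm : X.IsLE m) : IsTopFinite n X := by
  rw [isLE_iff] at hm
  have := ModuleCat.subsingleton_of_isZero (hm n h)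
  exact ⟨hX, (isLE_iff _ _).2 fun i hi => hm i (h.trans hi), inferInstance⟩

lemma IsTopFinite.ext₂ {n : ℤ} {X Y Z : DerivedCategory (ModuleCat.{u} R)} {f : X ⟶ Y} {g : Y ⟶ Z}
    {h : Z ⟶ X⟦(1 : ℤ)⟧} (hT : Triangle.mk f g h ∈ distTriang _) (hX : IsTopFinite n X)
    (hZ : IsTopFinite n Z) : IsTopFinite n Y := by
  have hex (i : ℤ) (y : (homologyFunctor (ModuleCat.{u} R) i).obj Y)
      (hy : (homologyFunctor (ModuleCat.{u} R) i).map g y = 0) :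
      ∃ x, (homologyFunctor (ModuleCat.{u} R) i).map f x = y :=
    (ShortComplex.moduleCat_exact_iff _).1 (HomologySequence.exact₂ _ hT i) y hy
  refine ⟨hX.isCompactObject.ext₂ hT hZ.isCompactObject, ?_, ?_⟩
  · have h₁ := hX.isLE
    have h₃ := hZ.isLE
    rw [isLE_iff] at h₁ h₃ ⊢
    intro i hi
    exact (HomologySequence.exact₂ _ hT i).isZero_of_both_zeros
      ((h₁ i hi).eq_of_src _ _) ((h₃ i hi).eq_of_tgt _ _)
  · have := hX.finite
    have := hZ.finite
    have hZ' : Function.Surjective ((homologyFunctor (ModuleCat.{u} R) n).map g) := by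
      intro z
      refine (ShortComplex.moduleCat_exact_iff _).1
        (HomologySequence.exact₃ _ hT n (n + 1) rfl) z ?_
      have := hX.isLE
      rw [isLE_iff] at this
      have := ModuleCat.subsingleton_of_isZero (this (n + 1) (by lia))
      exact this.elim _ _
    refine ⟨Submodule.fg_of_fg_map_of_fg_inf_ker
      ((homologyFunctor (ModuleCat.{u} R) n).map g).hom ?_ ?_⟩
    · rw [Submodule.map_top, LinearMap.range_eq_top.2 hZ']
      exact Module.Finite.fg_top
    · have : ((homologyFunctor (ModuleCat.{u} R) n).map g).hom.ker =
          ((homologyFunctor (ModuleCat.{u} R) n).map f).hom.range := by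
        refine le_antisymm (fun y hy => hex n y hy) ?_
        rintro _ ⟨x, rfl⟩
        change (homologyFunctor (ModuleCat.{u} R) n).map g
          ((homologyFunctor (ModuleCat.{u} R) n).map f x) = 0
        rw [← ModuleCat.comp_apply, ← Functor.map_comp, comp_eq_zero₁₂_of_distTriang hT,
          Functor.map_zero]
        rfl
      rw [top_inf_eq, this, LinearMap.range_eq_map]
      exact Module.Finite.fg_top.map _

lemma isLE_of_isColimit_cofan {n : ℤ} {J : Type u}
    {b : Cofan fun _ : J => sgl n (ModuleCat.of R R)} (hb : IsColimit b) : b.pt.IsLE n := by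
  rw [isLE_iff]
  intro i hi
  have hz : (homologyFunctor (ModuleCat.{u} R) i).map (𝟙 b.pt) = 0 := by
    refine homologyFunctor_map_eq_zero_of_inj hb _ i fun j => ?_
    have : IsZero ((homologyFunctor (ModuleCat.{u} R) i).obj (sgl n (ModuleCat.of R R))) :=
      ((singleFunctor (ModuleCat.{u} R) n).obj (ModuleCat.of R R)).isZero_of_isLE n i hi
    exact this.eq_of_src _ _
  rw [CategoryTheory.Functor.map_id] at hz
  exact (IsZero.iff_id_eq_zero _).2 hz

lemma isTopFinite_of_finite {n : ℤ} {J : Type u} [Finite J]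
    {b : Cofan fun _ : J => sgl n (ModuleCat.of R R)} (hb : IsColimit b) : IsTopFinite n b.pt := by
  refine ⟨isCompactObject_of_finite hb fun _ => isCompactObject_sgl R n, isLE_of_isColimit_cofan hb, ?_⟩
  · let H := homologyFunctor (ModuleCat.{u} R) n
    have := Fintype.ofFinite J
    have : Module.Finite R (H.obj (sgl n (ModuleCat.of R R))) :=
      Module.Finite.equiv (homologySglIso n (ModuleCat.of R R)).symm.toLinearEquiv
    refine Module.Finite.of_surjective
      (∑ j, (H.map (b.inj j)).hom ∘ₗ LinearMap.proj (φ := fun _ => H.obj _) j) fun x => ?_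
    have hid : trunc hb Finset.univ = 𝟙 _ := Cofan.IsColimit.hom_ext hb _ _ fun j =>
      (inj_trunc hb (Finset.mem_univ j)).trans (Category.comp_id _).symm
    have hx : x = H.map (trunc hb Finset.univ) x := by
      rw [hid, CategoryTheory.Functor.map_id]
      rfl
    refine ⟨fun j => H.map (proj hb j) x, ?_⟩
    conv_rhs => rw [hx, trunc, Functor.map_sum]
    simp only [Functor.map_comp]
    rw [LinearMap.sum_apply]
    change _ = ModuleCat.Hom.hom _ x
    rw [ModuleCat.hom_sum, LinearMap.sum_apply]
    rfl

/-- The morphism `φ` is obtained by attaching shifts of `R` in a given degree. -/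
def IsAttachment (n : ℤ) {X Y : DerivedCategory (ModuleCat.{u} R)} (φ : X ⟶ Y) : Prop :=
  ∃ (J : Type u) (c : Cofan fun _ : J => sgl n (ModuleCat.of R R)) (_ : IsColimit c) (p : c.pt ⟶ X)
    (δ : Y ⟶ c.pt⟦(1 : ℤ)⟧), Triangle.mk p φ δ ∈ distTriang _

/-- A factorization after the attachment is pulled back before it: `U` maps to the shifted coproduct
through a finite part `F`, and the fibre `W` of `U ⟶ F⟦1⟧` maps to `X`. The error `f - l ≫ r` dies
in `Y`, hence comes from a finite part `F'` of the coproduct, so `V = W ⊞ F'` works. -/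
lemma IsAttachment.exists_isTopFinite_factorization {n : ℤ}
    {X Y : DerivedCategory (ModuleCat.{u} R)} {φ : X ⟶ Y} (hφ : IsAttachment n φ)
    {S U : DerivedCategory (ModuleCat.{u} R)} (hS : IsCompactObject.{u} S) (f : S ⟶ X)
    (hU : IsTopFinite n U) (a : S ⟶ U) (b : U ⟶ Y) (hab : a ≫ b = f ≫ φ) :
    ∃ (V : DerivedCategory (ModuleCat.{u} R)) (a' : S ⟶ V) (b' : V ⟶ X),
      IsTopFinite n V ∧ a' ≫ b' = f := by
  obtain ⟨J, c, hc, p, δ, hT⟩ := hφ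
  have hfin (s : Finset J) : ∃ (F : DerivedCategory (ModuleCat.{u} R)) (ι : F ⟶ c.pt)
      (ρ : c.pt ⟶ F), IsTopFinite n F ∧ ρ ≫ ι = trunc hc s := by
    obtain ⟨d, ⟨hd⟩⟩ : ∃ d : Cofan fun _ : s => sgl n (ModuleCat.of R R), Nonempty (IsColimit d) :=
      ⟨_, ⟨coproductIsCoproduct _⟩⟩
    obtain ⟨ι, ρ, -, h⟩ := exists_retract_trunc hc s hd
    exact ⟨d.pt, ι, ρ, isTopFinite_of_finite hd, h⟩
  obtain ⟨s, hs⟩ := exists_comp_map_shift_trunc_eq hU.isCompactObject hc 1 (b ≫ δ)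
  obtain ⟨F, ι, ρ, hF, hρ⟩ := hfin s
  obtain ⟨W, i, q, hT'⟩ := distinguished_cocone_triangle₂ (b ≫ δ ≫ ρ⟦(1 : ℤ)⟧')
  obtain ⟨r, -, hr⟩ := exists_map₂_of_distTriang hT' hT ι b (by
    rw [← hs, ← hρ, Functor.map_comp]
    simp only [Category.assoc])
  obtain ⟨l, hl⟩ := exists_lift₃_of_distTriang hT' a (by
    rw [reassoc_of% hab, reassoc_of% (comp_eq_zero₂₃_of_distTriang hT), zero_comp, comp_zero])
  obtain ⟨e, he⟩ := exists_lift_of_distTriang hT (f - l ≫ r) (by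
    rw [Preadditive.sub_comp, Category.assoc, ← hr, reassoc_of% hl, hab, sub_self])
  obtain ⟨t, ht⟩ := hS.exists_comp_trunc_eq hc e
  obtain ⟨F', ι', ρ', hF', hρ'⟩ := hfin t
  refine ⟨W ⊞ F', biprod.lift l (e ≫ ρ'), biprod.desc r (ι' ≫ p),
    (hF.ext₂ hT' hU).ext₂ (binaryBiproductTriangle_distinguished W F') hF', ?_⟩
  rw [biprod.lift_desc, Category.assoc, reassoc_of% hρ', reassoc_of% ht, he, add_sub_cancel]

/-- A morphism from a compact object which vanishes after finitely many attachments in decreasing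
degrees factors through a compact object with finitely generated top cohomology. -/
lemma exists_isTopFinite_factorization {S : DerivedCategory (ModuleCat.{u} R)}
    (hS : IsCompactObject.{u} S) (k : ℕ) (n : ℤ) (X : ℕ → DerivedCategory (ModuleCat.{u} R))
    (φ : ∀ k, X k ⟶ X (k + 1)) (hφ : ∀ k : ℕ, IsAttachment (n - k) (φ k)) (g : ∀ k, S ⟶ X k)
    (hg : ∀ k, g (k + 1) = g k ≫ φ k) (hk : g k = 0) :
    ∃ (V : DerivedCategory (ModuleCat.{u} R)) (a : S ⟶ V) (b : V ⟶ X 0),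
      IsTopFinite n V ∧ a ≫ b = g 0 := by
  induction k generalizing n X with
  | zero =>
    obtain ⟨Z, hZ⟩ := HasZeroObject.zero (C := DerivedCategory (ModuleCat.{u} R))
    refine ⟨Z, 0, 0, isTopFinite_of_isLE (isCompactObject_of_isZero hZ) (sub_one_lt n) ?_, ?_⟩
    · rw [isLE_iff]
      exact fun i _ => (homologyFunctor (ModuleCat.{u} R) i).map_isZero hZ
    · rw [comp_zero, hk]
  | succ k ih =>
    obtain ⟨V, a, b, hV, hab⟩ := ih (n - 1) (fun k => X (k + 1)) (fun k => φ (k + 1))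
      (fun k => by
        have := hφ (k + 1)
        rwa [show n - ((k + 1 : ℕ) : ℤ) = n - 1 - k by push_cast; ring] at this)
      (fun k => g (k + 1)) (fun k => hg (k + 1)) hk
    have h0 : IsAttachment n (φ 0) := by simpa using hφ 0
    -- The inductive `V` lives in degrees at most `n - 1`, so its cohomology in degree `n` is zero,
    -- in particular finitely generated.
    exact h0.exists_isTopFinite_factorization hS (g 0)
      (isTopFinite_of_isLE hV.isCompactObject (sub_one_lt n) hV.isLE) a b (hab.trans (hg 0))

/-- The cone of the morphism attaching shifts of `R` along all the cohomology classes of top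
degree. -/
lemma exists_isAttachment {n : ℤ} (X : DerivedCategory (ModuleCat.{u} R)) (hX : X.IsLE n) :
    ∃ (Y : DerivedCategory (ModuleCat.{u} R)) (φ : X ⟶ Y), IsAttachment n φ ∧ Y.IsLE (n - 1) := by
  choose g hg using fun x : (homologyFunctor (ModuleCat.{u} R) n).obj X => exists_sgl_hom x
  obtain ⟨c, ⟨hc⟩⟩ : ∃ c : Cofan fun _ : (homologyFunctor (ModuleCat.{u} R) n).obj X =>
      sgl n (ModuleCat.of R R), Nonempty (IsColimit c) := ⟨_, ⟨coproductIsCoproduct _⟩⟩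
  obtain ⟨Y, φ, δ, hT⟩ := distinguished_cocone_triangle (Cofan.IsColimit.desc hc g)
  refine ⟨Y, φ, ⟨_, c, hc, _, δ, hT⟩, ?_⟩
  have hsurj (i : ℤ) (hi : n ≤ i) (y : (homologyFunctor (ModuleCat.{u} R) i).obj Y) :
      ∃ x, (homologyFunctor (ModuleCat.{u} R) i).map φ x = y := by
    refine (ShortComplex.moduleCat_exact_iff _).1
      (HomologySequence.exact₃ _ hT i (i + 1) rfl) y ?_
    have := isLE_of_isColimit_cofan hc
    rw [isLE_iff] at this
    have := ModuleCat.subsingleton_of_isZero (this (i + 1) (by lia))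
    exact this.elim _ _
  rw [isLE_iff] at hX ⊢
  intro i hi
  rw [ModuleCat.isZero_iff_subsingleton]
  refine subsingleton_of_forall_eq 0 fun y => ?_
  obtain ⟨x, rfl⟩ := hsurj i (by lia) y
  obtain rfl | hi' := eq_or_lt_of_le (show n ≤ i by lia)
  · obtain ⟨z, rfl⟩ : ∃ z, (homologyFunctor (ModuleCat.{u} R) n).map
        (Cofan.IsColimit.desc hc g) z = x := by
      refine ⟨(homologyFunctor _ n).map (c.inj x)
        ((homologySglIso n (ModuleCat.of R R)).inv (1 : R)), ?_⟩
      rw [← ModuleCat.comp_apply, ← Functor.map_comp, Cofan.IsColimit.fac]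
      exact hg x
    rw [← ModuleCat.comp_apply, ← Functor.map_comp, comp_eq_zero₁₂_of_distTriang hT,
      Functor.map_zero]
    rfl
  · have := ModuleCat.subsingleton_of_isZero (hX i hi')
    rw [this.elim x 0, map_zero]

/-- The top cohomology of a compact object is finitely generated. -/
lemma IsCompactObject.finite_homology {S : DerivedCategory (ModuleCat.{u} R)}
    (hS : IsCompactObject.{u} S) {n : ℤ} (hn : S.IsLE n) :
    Module.Finite R ((homologyFunctor (ModuleCat.{u} R) n).obj S) := by
  choose Y φ hφ hY using fun (m : ℤ) (X : {X : DerivedCategory (ModuleCat.{u} R) // X.IsLE m}) =>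
    exists_isAttachment X.1 X.2
  let X (k : ℕ) : {X : DerivedCategory (ModuleCat.{u} R) // X.IsLE (n - k)} :=
    Nat.rec ⟨S, by simpa using hn⟩ (fun k X => ⟨Y (n - k) X, by
      have := hY (n - k) X
      rwa [sub_sub, ← Nat.cast_succ] at this⟩) k
  let g (k : ℕ) : S ⟶ (X k).1 := Nat.rec (𝟙 S) (fun k g => g ≫ φ (n - k) (X k)) k
  -- Stage `k` has cohomology only in degrees at most `n - k`, so degree `m` is empty from stage `n
  -- - m + 1` on.
  obtain ⟨k, hk⟩ := exists_eq_zero_of_isCompactObject (X := fun k => (X k).1)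
    (fun k => φ (n - k) (X k)) hS (fun m => ⟨(n - m + 1).toNat, fun k hk => by
      have := (X k).2
      rw [isLE_iff] at this
      exact this m (by lia)⟩) g (fun k => rfl)
  obtain ⟨V, a, b, hV, hab⟩ := exists_isTopFinite_factorization hS k n (fun k => (X k).1)
    (fun k => φ (n - k) (X k)) (fun k => hφ (n - k) (X k)) g (fun k => rfl) hk
  have := hV.finite
  -- Since `g 0` is the identity, `S` is a retract of `V`.
  refine Module.Finite.of_surjective ((homologyFunctor (ModuleCat.{u} R) n).map b).hom fun x => ?_
  refine ⟨(homologyFunctor (ModuleCat.{u} R) n).map a x, ?_⟩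
  change (homologyFunctor (ModuleCat.{u} R) n).map b _ = x
  rw [← ModuleCat.comp_apply, ← Functor.map_comp, hab]
  change (homologyFunctor (ModuleCat.{u} R) n).map (𝟙 S) x = x
  rw [CategoryTheory.Functor.map_id]
  rfl

/-- Compact objects are bounded above. -/
lemma IsCompactObject.exists_isLE {S : DerivedCategory (ModuleCat.{u} R)}
    (hS : IsCompactObject.{u} S) : ∃ n : ℤ, S.IsLE n := by
  let t := TStructure.t (C := ModuleCat.{u} R)
  -- Each degree of cohomology eventually disappears from the truncations above `k`, so by
  -- compactness the map from `S` to one of them is zero, and `S` has no cohomology from degree `k`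
  -- on.
  obtain ⟨k, hk⟩ := exists_eq_zero_of_isCompactObject (X := fun k : ℕ => (t.truncGE (k : ℤ)).obj S)
    (fun k => (t.natTransTruncGEOfLE (k : ℤ) ((k + 1 : ℕ) : ℤ) (by lia)).app S) hS
    (fun m => ⟨(m + 1).toNat, fun k hk => by
      have : ((t.truncGE (k : ℤ)).obj S).IsGE k := inferInstanceAs (t.IsGE _ _)
      rw [isGE_iff] at this
      exact this m (by lia)⟩)
    (fun k => (t.truncGEπ (k : ℤ)).app S)
    (fun k => (t.π_natTransTruncGEOfLE_app _ _ _ S).symm)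
  refine ⟨k - 1, ?_⟩
  have h : ((t.truncLT (k : ℤ)).obj S).IsLE (k - 1) := inferInstanceAs (t.IsLE _ _)
  rw [isLE_iff] at h ⊢
  intro i hi
  have hex := HomologySequence.exact₂ _ (t.triangleLTGE_distinguished (k : ℤ) S) i
  refine hex.isZero_of_both_zeros ((h i hi).eq_of_src _ _) ?_
  exact (congrArg (homologyFunctor (ModuleCat.{u} R) i).map hk).trans (Functor.map_zero _ _ _)

end DerivedTelescope

/-! ### Nakayama, pseudoflatness, and the failure of compact generation. -/

namespace DerivedTelescope

open DerivedCategory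

section Nakayama

variable {R : Type u} [CommRing R] [IsLocalRing R]

/-- A finitely generated module over a local ring without nonzero linear maps to the residue field
is zero. -/
lemma subsingleton_of_forall_residueField {M : Type u} [AddCommGroup M] [Module R M]
    [Module.Finite R M] (h : ∀ f : M →ₗ[R] IsLocalRing.ResidueField R, f = 0) : Subsingleton M := by
  rw [← IsLocalRing.subsingleton_tensorProduct (R := R)]
  refine subsingleton_of_forall_eq 0 fun x => ?_
  refine (Module.forall_dual_apply_eq_zero_iff (IsLocalRing.ResidueField R) x).1 fun φ => ?_
  have hφ : φ = 0 := by
    refine TensorProduct.AlgebraTensorModule.curry_injective (LinearMap.ext_ring ?_)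
    exact h ((φ.restrictScalars R) ∘ₗ TensorProduct.mk R (IsLocalRing.ResidueField R) M 1)
  rw [hφ, LinearMap.zero_apply]

end Nakayama

section PseudoFlat

variable {R : Type u} [CommRing R]

open scoped TensorProduct in
lemma one_tmul_eq_zero_iff (I : Ideal R) {M : Type*} [AddCommGroup M] [Module R M] (x : M) :
    (1 : R ⧸ I) ⊗ₜ[R] x = 0 ↔ x ∈ I • (⊤ : Submodule R M) := by
  rw [← (TensorProduct.quotTensorEquivQuotSMul M I).map_eq_zero_iff,
    ← map_one (Ideal.Quotient.mk I), TensorProduct.quotTensorEquivQuotSMul_mk_tmul, one_smul,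
    Submodule.Quotient.mk_eq_zero]

open scoped TensorProduct in
-- As `I` kills `Q`, `I P₀` lies in the image of `d₁`, so `I P₀ = I (I P₀)` lies in `d₁ (I P₁)`. An
-- element of `P₁` sent into `I P₀` thus becomes a cycle after a correction in `I P₁`, invisible
-- modulo `I`.
lemma exact_lTensor_quotient_of_idempotent {I : Ideal R} (hI : I * I = I) {P₀ P₁ P₂ Q : Type*}
    [AddCommGroup P₀] [Module R P₀] [AddCommGroup P₁] [Module R P₁] [AddCommGroup P₂] [Module R P₂]
    [AddCommGroup Q] [Module R Q] {d₂ : P₂ →ₗ[R] P₁} {d₁ : P₁ →ₗ[R] P₀} {ε : P₀ →ₗ[R] Q}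
    (h₁ : Function.Exact d₂ d₁) (h₀ : Function.Exact d₁ ε) (hQ : ∀ a ∈ I, ∀ q : Q, a • q = 0) :
    Function.Exact (d₂.lTensor (R ⧸ I)) (d₁.lTensor (R ⧸ I)) := by
  have hle : I • (⊤ : Submodule R P₀) ≤ LinearMap.range d₁ := by
    refine Submodule.smul_le.2 fun a ha y _ => (h₀ _).1 ?_
    rw [map_smul, hQ a ha]
  have hle' : I • (⊤ : Submodule R P₀) ≤ (I • (⊤ : Submodule R P₁)).map d₁ := by
    rw [Submodule.map_smul'', Submodule.map_top]
    conv_lhs => rw [← hI, Submodule.mul_smul]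
    exact Submodule.smul_mono le_rfl hle
  have hsurj (z : (R ⧸ I) ⊗[R] P₁) : ∃ x : P₁, (1 : R ⧸ I) ⊗ₜ[R] x = z := by
    induction z with
    | zero => exact ⟨0, TensorProduct.tmul_zero _ _⟩
    | tmul r x =>
      obtain ⟨r, rfl⟩ := Ideal.Quotient.mk_surjective r
      refine ⟨r • x, ?_⟩
      rw [← TensorProduct.smul_tmul, Algebra.smul_def, mul_one]
      rfl
    | add z z' hz hz' =>
      obtain ⟨x, rfl⟩ := hz
      obtain ⟨x', rfl⟩ := hz'
      exact ⟨x + x', TensorProduct.tmul_add _ _ _⟩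
  intro z
  constructor
  · intro hz
    obtain ⟨x, rfl⟩ := hsurj z
    rw [LinearMap.lTensor_tmul, one_tmul_eq_zero_iff] at hz
    obtain ⟨x', hx', hd⟩ := hle' hz
    obtain ⟨w, hw⟩ := (h₁ (x - x')).1 (by rw [map_sub, hd, sub_self])
    refine ⟨1 ⊗ₜ[R] w, ?_⟩
    rw [LinearMap.lTensor_tmul, hw, TensorProduct.tmul_sub, (one_tmul_eq_zero_iff I x').2 hx', sub_zero]
  · rintro ⟨y, rfl⟩
    rw [← LinearMap.comp_apply, ← LinearMap.lTensor_comp, h₁.linearMap_comp_eq_zero,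
      LinearMap.lTensor_zero, LinearMap.zero_apply]

lemma isZero_tor_one_quotient {I : Ideal R} (hI : I * I = I) :
    IsZero (((Tor (ModuleCat.{u} R) 1).obj (ModuleCat.of R (R ⧸ I))).obj
      (ModuleCat.of R (R ⧸ I))) := by
  let F := (MonoidalCategory.tensoringLeft (ModuleCat.{u} R)).obj (ModuleCat.of R (R ⧸ I))
  let P := projectiveResolution (ModuleCat.of R (R ⧸ I))
  refine IsZero.of_iso ?_ (P.isoLeftDerivedObj F 1)
  refine (HomologicalComplex.exactAt_iff_isZero_homology _ _).1 ?_
  rw [HomologicalComplex.exactAt_iff' _ 2 1 0 (by simp) (by simp), ShortComplex.moduleCat_exact_iff]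
  have h₁ : Function.Exact (P.complex.d 2 1).hom (P.complex.d 1 0).hom := by
    exact (ShortComplex.ShortExact.moduleCat_exact_iff_function_exact _).1 (P.exact_succ 0)
  have h₀ : Function.Exact (P.complex.d 1 0).hom (P.π.f 0).hom := by
    exact (ShortComplex.ShortExact.moduleCat_exact_iff_function_exact _).1 P.exact₀
  intro z hz
  refine (exact_lTensor_quotient_of_idempotent hI h₁ h₀ (fun a ha q => ?_) z).1 hz
  obtain ⟨r, hr⟩ := Ideal.Quotient.mk_surjective (show R ⧸ I from q)
  change a • (show R ⧸ I from q) = 0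
  rw [← hr, Algebra.smul_def, Ideal.Quotient.algebraMap_eq, Ideal.Quotient.eq_zero_iff_mem.2 ha,
    zero_mul]

lemma isPseudoflatEpi_quotient {I : Ideal R} (hI : I * I = I) : IsPseudoflatEpi R (R ⧸ I) := by
  refine ⟨?_, isZero_tor_one_quotient hI⟩
  have : Function.Surjective (RingCat.ofHom (algebraMap R (R ⧸ I))) := Ideal.Quotient.mk_surjective
  exact ConcreteCategory.epi_of_surjective _ this

/-- By flatness the relation `a • 1 = 0` is trivial: 1 is congruent modulo `I` to a combination of
elements annihilating `a`. That combination is a unit since `R` is local, so `a = 0`. -/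
lemma not_flat_quotient [IsLocalRing R] {I : Ideal R} (hI : I ≠ ⊤) (hI' : I ≠ ⊥) :
    ¬ Module.Flat R (R ⧸ I) := by
  intro hflat
  refine hI' (eq_bot_iff.2 fun a ha => ?_)
  have hrel : ∑ i : Fin 1, (fun _ => a) i • (fun _ => (1 : R ⧸ I)) i = 0 := by
    rw [Fin.sum_univ_one, Algebra.smul_def, mul_one, Ideal.Quotient.algebraMap_eq]
    exact Ideal.Quotient.eq_zero_iff_mem.2 ha
  obtain ⟨k, c, y, hy, hc⟩ := Module.Flat.iff_forall_isTrivialRelation.1 hflat hrel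
  simp only [Fin.sum_univ_one] at hc
  choose r hr using fun j => Ideal.Quotient.mk_surjective (y j)
  have hmem : 1 - ∑ j, c 0 j * r j ∈ I := by
    rw [← Ideal.Quotient.eq_zero_iff_mem, map_sub, map_one, map_sum, sub_eq_zero]
    refine (hy 0).trans ?_
    refine Finset.sum_congr rfl fun j _ => ?_
    rw [map_mul, hr, Algebra.smul_def, Ideal.Quotient.algebraMap_eq]
  have hu : IsUnit (∑ j, c 0 j * r j) := by
    have := IsLocalRing.isUnit_one_sub_self_of_mem_nonunits _ (IsLocalRing.le_maximalIdeal hI hmem)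
    rwa [sub_sub_cancel] at this
  refine hu.mul_left_eq_zero.1 ?_
  rw [Finset.mul_sum]
  exact Finset.sum_eq_zero fun j _ => by rw [← mul_assoc, hc, zero_mul]

end PseudoFlat

variable {R : Type u} [CommRing R] [HasDerivedCategory.{w} (ModuleCat.{u} R)]

/-- Represent `S` by a complex that is zero above degree `n`. Everything in degree `n` is then a
cycle, so a map from the top cohomology to `N` is induced by a chain map to `N` in degree `n`. -/
lemma eq_zero_of_forall_hom_sgl_eq_zero {S : DerivedCategory (ModuleCat.{u} R)} {n : ℤ}
    (hS : S.IsLE n) {N : ModuleCat.{u} R} (h : ∀ f : S ⟶ sgl n N, f = 0)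
    (g : (homologyFunctor (ModuleCat.{u} R) n).obj S ⟶ N) : g = 0 := by
  obtain ⟨K, hK, ⟨e⟩⟩ := exists_iso_Q_obj_of_isLE S n
  suffices ∀ g : K.homology n ⟶ N, g = 0 by
    let e' : K.homology n ≅ (homologyFunctor (ModuleCat.{u} R) n).obj S :=
      (homologyQIso K n).symm ≪≫ (homologyFunctor (ModuleCat.{u} R) n).mapIso e.symm
    rw [← cancel_epi e'.hom, this (e'.hom ≫ g), comp_zero]
  intro g
  have hd : 𝟙 (K.X n) ≫ K.d n (n + 1) = 0 :=
    (K.isZero_of_isStrictlyLE n (n + 1) (by lia)).eq_of_tgt _ _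
  let l : K.X n ⟶ K.cycles n := K.liftCycles (𝟙 _) (n + 1) (by simp) hd
  have hl : l ≫ K.iCycles n = 𝟙 _ := K.liftCycles_i _ _ _ _
  have hl' : K.iCycles n ≫ l = 𝟙 _ := by
    rw [← cancel_mono (K.iCycles n), Category.assoc, hl, Category.comp_id, Category.id_comp]
  let φ : K ⟶ (HomologicalComplex.single _ (ComplexShape.up ℤ) n).obj N :=
    HomologicalComplex.mkHomToSingle (l ≫ K.homologyπ n ≫ g) (fun i hi => by
      have : K.d i n ≫ l = K.toCycles i n := by
        rw [← cancel_mono (K.iCycles n), Category.assoc, hl, Category.comp_id, K.toCycles_i]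
      rw [reassoc_of% this, ← Category.assoc, K.toCycles_comp_homologyπ, zero_comp])
  have hφ : HomologicalComplex.homologyMap φ n = 0 := by
    have h0 : Q.map φ = 0 := by
      rw [← cancel_epi e.hom, comp_zero]
      exact h _
    have := homologyQIso_inv_naturality φ n
    rw [h0, Functor.map_zero, comp_zero] at this
    rw [← cancel_mono (homologyQIso _ n).inv, zero_comp]
    exact this.symm
  ext x
  obtain ⟨z, rfl⟩ := (ModuleCat.epi_iff_surjective (K.homologyπ n)).1 inferInstance x
  have h1 : ((HomologicalComplex.single _ (ComplexShape.up ℤ) n).obj N).homologyπ n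
      (HomologicalComplex.cyclesMap φ n z) = 0 := by
    rw [← ModuleCat.comp_apply, ← HomologicalComplex.homologyπ_naturality, hφ, comp_zero]
    rfl
  obtain ⟨y, hy⟩ := (homologyπ_eq_zero_iff _ _).1 h1
  have hy0 : y = 0 := (ModuleCat.subsingleton_of_isZero
    (HomologicalComplex.isZero_single_obj_X (ComplexShape.up ℤ) n N (n - 1) (by lia))).elim _ _
  rw [hy0, map_zero, ← ModuleCat.comp_apply, HomologicalComplex.cyclesMap_i,
    HomologicalComplex.mkHomToSingle_f] at hy
  have h2 : K.iCycles n ≫ l ≫ K.homologyπ n ≫ g = K.homologyπ n ≫ g := by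
    rw [reassoc_of% hl']
  have h3 := congrArg (HomologicalComplex.singleObjXSelf (ComplexShape.up ℤ) n N).hom hy
  rw [map_zero, ← ModuleCat.comp_apply] at h3
  simp only [Category.assoc, Iso.inv_hom_id, Category.comp_id] at h3
  rw [h2] at h3
  exact h3.symm

variable [IsLocalRing R]

/-- A compact object without nonzero morphisms to the shifts of the residue field is zero. -/
lemma IsCompactObject.isZero_of_forall_residueField {S : DerivedCategory (ModuleCat.{u} R)}
    (hS : IsCompactObject.{u} S)
    (h : ∀ n (f : S ⟶ sgl n (ModuleCat.of R (IsLocalRing.ResidueField R))), f = 0) : IsZero S := by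
  obtain ⟨n, hn⟩ := hS.exists_isLE
  -- Nakayama kills the top cohomology, which lowers the bound by one degree, indefinitely.
  have hle (k : ℕ) : S.IsLE (n - k) := by
    induction k with
    | zero => simpa using hn
    | succ k ih =>
      have hfin := hS.finite_homology ih
      have h0 : Subsingleton ((homologyFunctor (ModuleCat.{u} R) (n - k)).obj S) :=
        subsingleton_of_forall_residueField (R := R) fun f =>
          congrArg ModuleCat.Hom.hom
            (eq_zero_of_forall_hom_sgl_eq_zero ih (h (n - k)) (ModuleCat.ofHom f))
      rw [isLE_iff] at ih ⊢
      intro i hi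
      obtain rfl | hi' := eq_or_ne i (n - k)
      · exact ModuleCat.isZero_of_subsingleton _
      · exact ih i (by push_cast at hi; lia)
  have h0 : IsIso (0 : S ⟶ S) := by
    rw [DerivedCategory.isIso_iff]
    intro m
    have hz : IsZero ((homologyFunctor (ModuleCat.{u} R) m).obj S) := by
      have := hle (n - m + 1).toNat
      rw [isLE_iff] at this
      exact this m (by lia)
    exact ⟨0, hz.eq_of_src _ _, hz.eq_of_src _ _⟩
  exact (IsZero.iff_id_eq_zero S).2 ((cancel_epi (0 : S ⟶ S)).1 (by simp))

/-- The objects whose cohomology is annihilated by a proper nonzero ideal of a local ring are not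
the right orthogonal of a class of compact objects. -/
lemma not_isCompactlyGenerated_cohomologyFrom {I : Ideal R} (hI : I ≠ ⊤) (hI' : I ≠ ⊥) :
    ¬ IsCompactlyGenerated (cohomologyFrom R (R ⧸ I)) := by
  rw [cohomologyFrom_quotient_eq]
  rintro ⟨S, hS, hIS⟩
  have hz (s : DerivedCategory (ModuleCat.{u} R)) (hs : S s) : IsZero s := by
    refine (hS.isCompactObject s hs).isZero_of_forall_residueField fun n f => ?_
    -- A proper ideal lies in the maximal ideal, so the residue field in any degree belongs to the
    -- orthogonal of `S`.
    have hk : IsCohomologyKilledBy I (sgl n (ModuleCat.of R (IsLocalRing.ResidueField R))) := by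
      refine .sgl (fun a ha x => ?_) n
      change a • (show IsLocalRing.ResidueField R from x) = 0
      rw [Algebra.smul_def, IsLocalRing.ResidueField.algebraMap_eq,
        (IsLocalRing.residue_eq_zero_iff a).2 (IsLocalRing.le_maximalIdeal hI ha), zero_mul]
    rw [hIS] at hk
    have := hk hs 0 (f ≫ ((shiftFunctorZero _ ℤ).app _).inv)
    rwa [Preadditive.IsIso.comp_right_eq_zero] at this
  -- The orthogonal of zero objects is everything, in particular it contains `R`; then `a = a * 1 =
  -- 0` for every `a` in `I`.
  have hR : IsCohomologyKilledBy I (sgl 0 (ModuleCat.of R R)) := by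
    rw [hIS]
    exact fun s hs i g => (hz s hs).eq_of_src _ _
  refine hI' (eq_bot_iff.2 fun a ha => ?_)
  let e := (homologySglIso 0 (ModuleCat.of R R)).toLinearEquiv
  have h := congrArg e (hR a ha 0 (e.symm (1 : R)))
  rw [map_smul, e.apply_symm_apply, map_zero] at h
  exact (mul_one a).symm.trans h

end DerivedTelescope

theorem proposition5p7 (R : Type u) [CommRing R] [IsLocalRing R]
    [HasDerivedCategory.{w} (ModuleCat.{u} R)]
    (I : Ideal R) (hI_proper : I ≠ ⊤) (hI_nonzero : I ≠ ⊥) (hI_idem : I * I = I) :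
    (DerivedTelescope.IsPseudoflatEpi R (R ⧸ I) ∧ ¬ Module.Flat R (R ⧸ I)) ∧
    (DerivedTelescope.IsDefinableTensorIdeal (DerivedTelescope.cohomologyFrom R (R ⧸ I)) ∧
      DerivedTelescope.IsClosedUnderCohomology (DerivedTelescope.cohomologyFrom R (R ⧸ I)) ∧
      ¬ DerivedTelescope.IsCompactlyGenerated (DerivedTelescope.cohomologyFrom R (R ⧸ I))) ∧
    ¬ DerivedTelescope.RestrictedTelescopeConjecture R := by
  have h₁ := DerivedTelescope.isDefinableTensorIdeal_cohomologyFrom hI_idem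
  have h₂ := DerivedTelescope.isClosedUnderCohomology_cohomologyFrom I
  have h₃ := DerivedTelescope.not_isCompactlyGenerated_cohomologyFrom hI_proper hI_nonzero
  exact ⟨⟨DerivedTelescope.isPseudoflatEpi_quotient hI_idem,
    DerivedTelescope.not_flat_quotient hI_proper hI_nonzero⟩, ⟨h₁, h₂, h₃⟩,
    fun h => h₃ (h _ h₁ h₂)⟩
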